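/- **Posets and toggles.** Let $P$ be a finite poset. The piecewise-linear toggle $t_p\colon\mathbb R^P\to\mathbb R^P$ at $p\in P$ replaces $x_p$ by $\min_{q\gtrdot p}x_q+\max_{q\lessdot p}x_q-x_p$ and changes no other label (an empty $\max$ is $0$, an empty $\min$ is $1$). The transfer map $\phi\colon\mathbb R^P\to\mathbb R^P$ is $\phi(x)_p=x_p-\max_{q\lessdot p}x_q$, a bijection. Toggles at elements that do not form a cover relation commute; for a set $I\subseteq P$, $\rho_I$ denotes the composition of the toggles at all elements of $I$, each once, performed from top to bottom along a linear extension of $I$. On $[r]\times[s]$ with the product order, write $\rho_{i,j}$ for $\rho_{[i]\times[j]}$, let $F_k=\{(i,j): i-j=k\}$ and $m=\min(r,s)$, and let $$\mathrm{RSK}=\rho_{r-m+1,s-m+1}^{-1}\circ\cdots\circ\rho_{r-1,s-1}^{-1}\circ\phi^{-1},\qquad \mathrm{Pro}^P=\rho_{F_{r-s+1}}\circ\cdots\circ\rho_{F_{r-1}},\qquad \mathrm{Pro}^Q=\rho_{F_{r-s-1}}\circ\cdots\circ\rho_{F_{1-s}}.$$ Put $\Omega^P=\mathrm{RSK}^{-1}\circ\mathrm{Pro}^P\circ\mathrm{RSK}$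 and $\Omega^Q=\mathrm{RSK}^{-1}\circ\mathrm{Pro}^Q\circ\mathrm{RSK}$. **Moon polyominoes.** A moon polyomino is a finite set $\mathcal M\subset\mathbb Z\times\mathbb Z$ such that every up-diagonal $\{j:(i,j)\in\mathcal M\}$ and every down-diagonal $\{i:(i,j)\in\mathcal M\}$ is an interval of $\mathbb Z$, and any two up-diagonals (as subsets of $\mathbb Z$) are comparable under inclusion. Two moon polyominoes are equivalent if one is the image of the other under $(i,j)\mapsto(\sigma(i),\tau(j))$ for some permutations $\sigma,\tau$ of $\mathbb Z$. A rectangle is a product of two finite integer intervals. **The maps $\Omega_{\mathcal M\to\mathcal N}$.** Let $R=[a,b]\times[c,d]$ be a (nonempty) maximal rectangle contained in $\mathcal M$. Suppose that replacing every box $(i,j)\in\mathcal M\setminus R$ with $c\le j\le d$ by $(i,j-1)$, and keeping all other boxes, yields a moon polyomino $\mathcal N$; this is a shift of down-diagonals. The associated map $\mathbb R^{\mathcal M}\to\mathbb R^{\mathcal N}$ applies $\Omega^P$ to the labels in $R$ (identified with $[b-a+1]\times[d-c+1]$) and moves all other labels along with their boxes. Shifts of up-diagonals are defined symmetrically, replacing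 $(i,j)\in\mathcal M\setminus R$ with $a\le i\le b$ by $(i-1,j)$ and using $\Omega^Q$. These maps are bijections. For equivalent moon polyominoes $\mathcal M,\mathcal N$, a map $\Omega_{\mathcal M\to\mathcal N}\colon\mathbb R^{\mathcal M}\to\mathbb R^{\mathcal N}$ is any composition of the maps associated to a finite series of shifts of down- and up-diagonals, inverses of such shifts, and translations (which carry the labels along), leading from $\mathcal M$ to $\mathcal N$ through moon polyominoes. **Chains.** A strict southeast chain of $x\in\mathbb R_{\ge0}^{\mathcal M}$ is a set of boxes contained in some rectangle $S\subseteq\mathcal M$ that is an antichain in the product order and all of whose labels are nonzero. Let $L_{\mathcal M}(x)$ be the maximum size of a strict southeast chain of $x$. **Statement.** Let $\mathcal M$ and $\mathcal N$ be equivalent moon polyominoes. Then there is a map $\Omega_{\mathcal M\to\mathcal N}$ as above, and for every such map and every $x\in\mathbb R_{\ge0}^{\mathcal M}$, $$L_{\mathcal N}\bigl(\Omega_{\mathcal M\to\mathcal N}(x)\bigr)=L_{\mathcal M}(x).$$ -/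

import Mathlib

namespace MoonPolyomino

/-! ### Piecewise-linear toggles and the transfer map on a finite poset -/

section Poset

variable {P : Type*} [PartialOrder P] [Fintype P]

open Classical in
/-- The elements covering `p`. -/
noncomputable def upperCovers (p : P) : Finset P := Finset.univ.filter (fun q => p ⋖ q)

open Classical in
/-- The elements covered by `p`. -/
noncomputable def lowerCovers (p : P) : Finset P := Finset.univ.filter (fun q => q ⋖ p)

theorem lt_of_mem_lowerCovers {p q : P} (h : q ∈ lowerCovers p) : q < p := by
  classical
  exact (by simpa [lowerCovers] using h : q ⋖ p).lt

theorem lt_of_mem_upperCovers {p q : P} (h : q ∈ upperCovers p) : p < q := by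
  classical
  exact (by simpa [upperCovers] using h : p ⋖ q).lt

/-- Minimum of the labels of the upper covers of `p`; the empty minimum is `1`. -/
noncomputable def minAbove (x : P → ℝ) (p : P) : ℝ :=
  if h : (upperCovers p).Nonempty then (upperCovers p).inf' h x else 1

/-- Maximum of the labels of the lower covers of `p`; the empty maximum is `0`. -/
noncomputable def maxBelow (x : P → ℝ) (p : P) : ℝ :=
  if h : (lowerCovers p).Nonempty then (lowerCovers p).sup' h x else 0

theorem minAbove_congr {x y : P → ℝ} {p : P} (h : ∀ q, p < q → x q = y q) :
    minAbove x p = minAbove y p := by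
  unfold minAbove
  split_ifs with hne
  · exact Finset.inf'_congr hne rfl (fun q hq => h q (lt_of_mem_upperCovers hq))
  · rfl

theorem maxBelow_congr {x y : P → ℝ} {p : P} (h : ∀ q, q < p → x q = y q) :
    maxBelow x p = maxBelow y p := by
  unfold maxBelow
  split_ifs with hne
  · exact Finset.sup'_congr hne rfl (fun q hq => h q (lt_of_mem_lowerCovers hq))
  · rfl

open Classical in
/-- The piecewise-linear toggle at `p`, as a function. -/
noncomputable def toggleFun (p : P) (x : P → ℝ) : P → ℝ :=
  Function.update x p (minAbove x p + maxBelow x p - x p)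

theorem toggleFun_involutive (p : P) : Function.Involutive (toggleFun p) := by
  classical
  intro x
  have hx : ∀ v : ℝ, ∀ q, q ≠ p → Function.update x p v q = x q :=
    fun v q hq => Function.update_of_ne hq v x
  have h1 : minAbove (toggleFun p x) p = minAbove x p :=
    minAbove_congr (fun q hq => hx _ q hq.ne')
  have h2 : maxBelow (toggleFun p x) p = maxBelow x p :=
    maxBelow_congr (fun q hq => hx _ q hq.ne)
  funext q
  by_cases hq : q = p
  · subst hq
    have h3 : toggleFun q x q = minAbove x q + maxBelow x q - x q := by
      simp [toggleFun]
    have h4 : toggleFun q (toggleFun q x) q =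
        minAbove (toggleFun q x) q + maxBelow (toggleFun q x) q - toggleFun q x q :=
      Function.update_self _ _ _
    rw [h4, h1, h2, h3]
    ring
  · have h4 : toggleFun p (toggleFun p x) q = toggleFun p x q :=
      Function.update_of_ne hq _ _
    rw [h4]
    exact hx _ q hq

/-- The piecewise-linear toggle at `p`, a permutation of `ℝ^P`. -/
noncomputable def toggle (p : P) : Equiv.Perm (P → ℝ) :=
  (toggleFun_involutive p).toPerm (toggleFun p)

open Classical in
/-- The inverse of the transfer map, computed upwards from the minimal elements. -/
noncomputable def transferInv (x : P → ℝ) (p : P) : ℝ :=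
  x p + if h : (lowerCovers p).Nonempty then
    (lowerCovers p).attach.sup' (Finset.attach_nonempty_iff.mpr h)
      (fun q => transferInv x q.1) else 0
termination_by wellFounded_lt.wrap p
decreasing_by exact lt_of_mem_lowerCovers q.2

theorem transferInv_eq (x : P → ℝ) (p : P) :
    transferInv x p = x p + maxBelow (transferInv x) p := by
  rw [transferInv, maxBelow]
  split_ifs with h
  · congr 1
    apply le_antisymm
    · exact Finset.sup'_le _ _ (fun q _ => Finset.le_sup' (transferInv x) q.2)
    · refine Finset.sup'_le _ _ (fun q hq => ?_)
      exact Finset.le_sup' (fun q : {q // q ∈ lowerCovers p} => transferInv x q.1)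
        (Finset.mem_attach _ ⟨q, hq⟩)
  · rfl

/-- The transfer map `x_p ↦ x_p - max_{q ⋖ p} x_q`, a permutation of `ℝ^P`. -/
noncomputable def transfer : Equiv.Perm (P → ℝ) where
  toFun x p := x p - maxBelow x p
  invFun := transferInv
  left_inv := by
    intro x
    funext p
    induction p using WellFoundedLT.induction with
    | ind p ih =>
      rw [transferInv_eq, maxBelow_congr (y := x) ih]
      ring
  right_inv := by
    intro x
    funext p
    have h := transferInv_eq x p
    simp only
    linarith

end Poset

/-! ### RSK, promotion and `Ω` on the rectangle poset

The poset `[r] × [s]` is `Fin r × Fin s` with the product order; the element `(i, j)` of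
`[r] × [s]` is the pair `(i - 1, j - 1)` here. -/

section Rectangle

variable (r s : ℕ)

/-- Rowmotion `ρ_I` associated to `I`: toggle once at each element of `I`, from the top to the
bottom, along the lexicographic linear extension. (In a product of permutations the rightmost
factor acts first. Toggles at elements that do not form a cover relation commute, so any other
linear extension gives the same map.) -/
noncomputable def rowmotion (I : Finset (Fin r × Fin s)) : Equiv.Perm (Fin r × Fin s → ℝ) :=
  (((List.finRange r ×ˢ List.finRange s).filter (fun p => p ∈ I)).map toggle).prod

/-- The subset `[i] × [j]` of `[r] × [s]`, which is the order ideal generated by `(i, j)` if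
`1 ≤ i ≤ r` and `1 ≤ j ≤ s`. -/
def ideal (i j : ℕ) : Finset (Fin r × Fin s) :=
  Finset.univ.filter (fun p => p.1.val < i ∧ p.2.val < j)

/-- The `k`-th file, consisting of the elements `(i, j)` with `i - j = k`. -/
def file (k : ℤ) : Finset (Fin r × Fin s) :=
  Finset.univ.filter (fun p => (p.1.val : ℤ) - (p.2.val : ℤ) = k)

/-- `RSK = ρ_{r-m+1,s-m+1}⁻¹ ∘ ⋯ ∘ ρ_{r-2,s-2}⁻¹ ∘ ρ_{r-1,s-1}⁻¹ ∘ φ⁻¹` with `m = min r s`. -/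
noncomputable def RSK : Equiv.Perm (Fin r × Fin s → ℝ) :=
  ((List.range (min r s - 1)).map
    (fun t => (rowmotion r s (ideal r s (r - 1 - t) (s - 1 - t)))⁻¹)).reverse.prod * transfer⁻¹

/-- `Pro^P = ρ_{F_{r-s+1}} ∘ ⋯ ∘ ρ_{F_{r-1}}`: toggle in all files strictly left of `(r, s)`,
starting with the leftmost one. -/
noncomputable def proP : Equiv.Perm (Fin r × Fin s → ℝ) :=
  ((List.range (s - 1)).map
    (fun t : ℕ => rowmotion r s (file r s ((r : ℤ) - 1 - (t : ℤ))))).reverse.prod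

/-- `Pro^Q = ρ_{F_{r-s-1}} ∘ ⋯ ∘ ρ_{F_{1-s}}`, the transpose of `Pro^P`: toggle in all files
strictly right of `(r, s)`, starting with the rightmost one. -/
noncomputable def proQ : Equiv.Perm (Fin r × Fin s → ℝ) :=
  ((List.range (r - 1)).map
    (fun t : ℕ => rowmotion r s (file r s (1 - (s : ℤ) + (t : ℤ))))).reverse.prod

/-- `Ω = RSK⁻¹ ∘ Pro^P ∘ RSK`. -/
noncomputable def omegaP : Equiv.Perm (Fin r × Fin s → ℝ) :=
  (RSK r s)⁻¹ * proP r s * RSK r s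

/-- The transposed map `RSK⁻¹ ∘ Pro^Q ∘ RSK`. -/
noncomputable def omegaQ : Equiv.Perm (Fin r × Fin s → ℝ) :=
  (RSK r s)⁻¹ * proQ r s * RSK r s

end Rectangle

/-! ### Moon polyominoes

A polyomino is a finite subset of `ℤ × ℤ`. -/

/-- The `i`-th up-diagonal of `M`, as a set of second coordinates. -/
def upDiagonal (M : Finset (ℤ × ℤ)) (i : ℤ) : Set ℤ := {j | (i, j) ∈ M}

/-- The `j`-th down-diagonal of `M`, as a set of first coordinates. -/
def downDiagonal (M : Finset (ℤ × ℤ)) (j : ℤ) : Set ℤ := {i | (i, j) ∈ M}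

/-- Moon polyominoes: convex and intersection-free polyominoes. -/
structure IsMoon (M : Finset (ℤ × ℤ)) : Prop where
  up_convex : ∀ i, (upDiagonal M i).OrdConnected
  down_convex : ∀ j, (downDiagonal M j).OrdConnected
  intersection_free : ∀ i₁ i₂,
    upDiagonal M i₁ ⊆ upDiagonal M i₂ ∨ upDiagonal M i₂ ⊆ upDiagonal M i₁

/-- `N` is obtained from `M` by permuting up-diagonals and down-diagonals. -/
def Equivalent (M N : Finset (ℤ × ℤ)) : Prop :=
  ∃ σ τ : Equiv.Perm ℤ, N = M.image (fun p => (σ p.1, τ p.2))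

/-- The rectangle `[a, a + r - 1] × [c, c + s - 1]`. -/
noncomputable def rect (a c : ℤ) (r s : ℕ) : Finset (ℤ × ℤ) :=
  Finset.Ico a (a + r) ×ˢ Finset.Ico c (c + s)

/-- The given (nonempty) rectangle is a maximal subrectangle of `M`. -/
structure IsMaximalRect (M : Finset (ℤ × ℤ)) (a c : ℤ) (r s : ℕ) : Prop where
  r_pos : 0 < r
  s_pos : 0 < s
  subset : rect a c r s ⊆ M
  maximal : ∀ (a' c' : ℤ) (r' s' : ℕ), rect a c r s ⊆ rect a' c' r' s' →
    rect a' c' r' s' ⊆ M → rect a' c' r' s' = rect a c r s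

/-- Real labelings of the boxes of `M`. -/
abbrev Labeling (M : Finset (ℤ × ℤ)) : Type := {p : ℤ × ℤ // p ∈ M} → ℝ

/-- The label of a box. (The value `0` off `M` is only a default.) -/
def label {M : Finset (ℤ × ℤ)} (x : Labeling M) (p : ℤ × ℤ) : ℝ :=
  if h : p ∈ M then x ⟨p, h⟩ else 0

/-- The labels of the boxes of a rectangle, as a labeling of the poset `[r] × [s]`. -/
def restrict {M : Finset (ℤ × ℤ)} (x : Labeling M) (a c : ℤ) (r s : ℕ) : Fin r × Fin s → ℝ :=
  fun u => label x (a + (u.1.val : ℤ), c + (u.2.val : ℤ))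

/-- The element of the poset `[r] × [s]` that corresponds to a box of the rectangle. -/
def rectIndex {a c : ℤ} {r s : ℕ} (p : ℤ × ℤ) (h : p ∈ rect a c r s) : Fin r × Fin s :=
  (⟨(p.1 - a).toNat, by
      have h1 := (Finset.mem_product.mp h).1
      rw [Finset.mem_Ico] at h1
      omega⟩,
   ⟨(p.2 - c).toNat, by
      have h1 := (Finset.mem_product.mp h).2
      rw [Finset.mem_Ico] at h1
      omega⟩)

/-- `N` arises from `M` by shifting downward by one all boxes outside of the maximal rectangle
`R` that lie in the down-diagonals intersecting `R`. -/
def IsDownShift (M N : Finset (ℤ × ℤ)) (a c : ℤ) (r s : ℕ) : Prop :=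
  IsMaximalRect M a c r s ∧
    N = M.image (fun p =>
      if p.2 ∈ Finset.Ico c (c + s) ∧ p ∉ rect a c r s then (p.1, p.2 - 1) else p)

/-- `N` arises from `M` by shifting downward by one all boxes outside of the maximal rectangle
`R` that lie in the up-diagonals intersecting `R`. -/
def IsUpShift (M N : Finset (ℤ × ℤ)) (a c : ℤ) (r s : ℕ) : Prop :=
  IsMaximalRect M a c r s ∧
    N = M.image (fun p =>
      if p.1 ∈ Finset.Ico a (a + r) ∧ p ∉ rect a c r s then (p.1 - 1, p.2) else p)

/-- The map of labelings for a shift of down-diagonals: apply `RSK⁻¹ ∘ Pro^P ∘ RSK` inside of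
the rectangle and move the labels of the shifted boxes along with them. -/
noncomputable def omegaDown (M N : Finset (ℤ × ℤ)) (a c : ℤ) (r s : ℕ) (x : Labeling M) :
    Labeling N :=
  fun p =>
    if h : p.1 ∈ rect a c r s then omegaP r s (restrict x a c r s) (rectIndex p.1 h)
    else if p.1.2 ∈ Finset.Ico c (c + s) then label x (p.1.1, p.1.2 + 1)
    else label x p.1

/-- The map of labelings for a shift of up-diagonals: apply `RSK⁻¹ ∘ Pro^Q ∘ RSK` inside of
the rectangle and move the labels of the shifted boxes along with them. -/
noncomputable def omegaUp (M N : Finset (ℤ × ℤ)) (a c : ℤ) (r s : ℕ) (x : Labeling M) :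
    Labeling N :=
  fun p =>
    if h : p.1 ∈ rect a c r s then omegaQ r s (restrict x a c r s) (rectIndex p.1 h)
    else if p.1.1 ∈ Finset.Ico a (a + r) then label x (p.1.1 + 1, p.1.2)
    else label x p.1

/-- `IsOmega M N Ω`: the bijection `Ω : ℝ^M → ℝ^N` is the map obtained by composing the maps of
labelings along some series of shifts of down-diagonals and of up-diagonals from `M` to `N`
through moon polyominoes. A shift may be undone, by the inverse map, and polyominoes may be
translated along with their labels. -/
inductive IsOmega : (M N : Finset (ℤ × ℤ)) → (Labeling M ≃ Labeling N) → Prop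
  | down {M N : Finset (ℤ × ℤ)} (hM : IsMoon M) (hN : IsMoon N) (a c : ℤ) (r s : ℕ)
      (h : IsDownShift M N a c r s) (e : Labeling M ≃ Labeling N)
      (he : ∀ x, e x = omegaDown M N a c r s x) : IsOmega M N e
  | up {M N : Finset (ℤ × ℤ)} (hM : IsMoon M) (hN : IsMoon N) (a c : ℤ) (r s : ℕ)
      (h : IsUpShift M N a c r s) (e : Labeling M ≃ Labeling N)
      (he : ∀ x, e x = omegaUp M N a c r s x) : IsOmega M N e
  | translate {M N : Finset (ℤ × ℤ)} (hM : IsMoon M) (v : ℤ × ℤ)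
      (h : N = M.image (fun p => p + v)) (e : Labeling M ≃ Labeling N)
      (he : ∀ x p, label (e x) (p + v) = label x p) : IsOmega M N e
  | symm {M N : Finset (ℤ × ℤ)} {e : Labeling M ≃ Labeling N} (h : IsOmega M N e) :
      IsOmega N M e.symm
  | trans {M N K : Finset (ℤ × ℤ)} {e : Labeling M ≃ Labeling N} {f : Labeling N ≃ Labeling K}
      (h₁ : IsOmega M N e) (h₂ : IsOmega N K f) : IsOmega M K (e.trans f)

/-! ### Strict southeast chains -/

/-- A strict southeast chain of `x`: an antichain in some rectangle contained in `M` all of whose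
elements have a nonzero label. -/
structure IsStrictSoutheastChain {M : Finset (ℤ × ℤ)} (x : Labeling M) (A : Finset (ℤ × ℤ)) :
    Prop where
  in_rect : ∃ (a c : ℤ) (r s : ℕ), rect a c r s ⊆ M ∧ A ⊆ rect a c r s
  antichain : IsAntichain (· ≤ ·) (A : Set (ℤ × ℤ))
  ne_zero : ∀ p ∈ A, label x p ≠ 0

open Classical in
/-- `L_M(x)`: the maximum size of the strict southeast chains of `x`. -/
noncomputable def longestSE {M : Finset (ℤ × ℤ)} (x : Labeling M) : ℕ :=
  (M.powerset.filter (fun A => IsStrictSoutheastChain x A)).sup Finset.card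

end MoonPolyomino

namespace MoonPolyomino

/-! ### Strict southeast chains in a list of rows -/

/-! Call the first coordinate of a box its row and the second its column. Every map in question is
composed of elementary ones, so it is enough to treat a single shift, and to connect equivalent moon
polyominoes by shifts.

Inside the maximal rectangle `R` of size `r × s`, RSK stores the shapes of the subrectangles `[i] ×
[s]` and `[r] × [j]`: the recording and the insertion tableau. `proP` touches only the labels of the
second family, on which it acts as promotion; the recording tableau stays. Row insertion preserves
the sizes of strict southeast chains in every interval of columns (`chainEquiv_insertion`), so these
sizes depend on the insertion tableau alone (`chainEquiv_of_shape_eq`). Promotion erases the first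
column of this tableau and reinserts its first row into the rows below. Hence chains in an interval
of columns avoiding the first one correspond to chains in that interval moved by one
(`hasChain_iff_of_isPromotion`). By transposition, the unchanged recording tableau preserves the
chain sizes in all intervals of rows. Together this is `ShiftsChains`. Nonnegativity survives
because all toggles involved take place at non-maximal elements and preserve the cone of nonnegative
order-preserving labelings.

In the polyomino, the shift moves by one exactly the rows that miss `R` (`IsRowShift`). A chain in a
rectangle `S` either stays in the rows of `R`, and then its part in `R` is exchanged within the same
interval of rows; or it leaves them, and then the columns of `S` lie within those of `R`, avoid its
first column, and the part in `R` is exchanged within the interval of columns moved by one. In both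
cases the new part still forms an antichain with the rest, and convexity supplies a rectangle around
it (`IsRowShift.exists_isChainIn`).

For existence, shifting repeatedly at the first column, and then at the first row, sorts a moon
polyomino into a Young diagram (`IsMoon.exists_isYoung`). Young diagrams that differ by permutations
of rows and columns are equal (`IsYoung.eq`), so equivalent polyominoes are connected through a
common one. -/

/-- `HasChain c l d k`: the rows of `l`, read from the first to the last, contain `k` nonzero
entries whose columns strictly decrease and lie in `[c, d)`. -/
def HasChain (c : ℕ) : List (ℕ → ℝ) → ℕ → ℕ → Prop
  | [], _, k => k = 0
  | x :: l, d, k => HasChain c l d k ∨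
      ∃ q k', k = k' + 1 ∧ c ≤ q ∧ q < d ∧ x q ≠ 0 ∧ HasChain c l q k'

theorem HasChain.mono {c : ℕ} {l : List (ℕ → ℝ)} {d d' k : ℕ} (hd : d ≤ d')
    (h : HasChain c l d k) : HasChain c l d' k := by
  induction l generalizing d d' k with
  | nil => exact h
  | cons x l ih =>
    rcases h with h | ⟨q, k', hk, hc, hq, hx, h⟩
    · exact Or.inl (ih hd h)
    · exact Or.inr ⟨q, k', hk, hc, hq.trans_le hd, hx, h⟩

/-- Two lists of rows have chains of the same sizes in all column intervals `[c, d)` with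
`d ≤ s`. -/
def ChainEquiv (c s : ℕ) (l l' : List (ℕ → ℝ)) : Prop :=
  ∀ d ≤ s, ∀ k, HasChain c l d k ↔ HasChain c l' d k

namespace ChainEquiv

variable {c s : ℕ} {l l' l'' : List (ℕ → ℝ)}

theorem refl (c s : ℕ) (l : List (ℕ → ℝ)) : ChainEquiv c s l l := fun _ _ _ => Iff.rfl

theorem symm (h : ChainEquiv c s l l') : ChainEquiv c s l' l :=
  fun d hd k => (h d hd k).symm

theorem trans (h : ChainEquiv c s l l') (h' : ChainEquiv c s l' l'') : ChainEquiv c s l l'' :=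
  fun d hd k => (h d hd k).trans (h' d hd k)

theorem cons_congr {x y : ℕ → ℝ} (hxy : ∀ q, c ≤ q → q < s → x q = y q)
    (h : ChainEquiv c s l l') : ChainEquiv c s (x :: l) (y :: l') := by
  intro d hd k
  refine or_congr (h d hd k) (exists_congr fun q => exists_congr fun k' => ?_)
  constructor
  · rintro ⟨h1, h2, h3, h4, h5⟩
    exact ⟨h1, h2, h3, hxy q h2 (h3.trans_le hd) ▸ h4, (h q (h3.le.trans hd) k').1 h5⟩
  · rintro ⟨h1, h2, h3, h4, h5⟩
    exact ⟨h1, h2, h3, (hxy q h2 (h3.trans_le hd)).symm ▸ h4, (h q (h3.le.trans hd) k').2 h5⟩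

theorem cons (x : ℕ → ℝ) (h : ChainEquiv c s l l') : ChainEquiv c s (x :: l) (x :: l') :=
  cons_congr (fun _ _ _ => rfl) h

theorem zero_cons {x : ℕ → ℝ} (hx : ∀ q, c ≤ q → q < s → x q = 0) (l : List (ℕ → ℝ)) :
    ChainEquiv c s (x :: l) l := by
  intro d hd k
  refine ⟨?_, Or.inl⟩
  rintro (h | ⟨q, k', -, h2, h3, h4, -⟩)
  · exact h
  · exact absurd (hx q h2 (h3.trans_le hd)) h4

theorem map_congr {ι : Type*} {f g : ι → ℕ → ℝ} {a : List ι}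
    (h : ∀ i ∈ a, ∀ q, c ≤ q → q < s → f i q = g i q) :
    ChainEquiv c s (a.map f) (a.map g) := by
  induction a with
  | nil => exact refl c s []
  | cons i a ih =>
    exact cons_congr (h i List.mem_cons_self) (ih fun j hj => h j (List.mem_cons_of_mem _ hj))

theorem zero_map_append {ι : Type*} {f : ι → ℕ → ℝ} {a : List ι}
    (h : ∀ i ∈ a, ∀ q, c ≤ q → q < s → f i q = 0) (l : List (ℕ → ℝ)) :
    ChainEquiv c s (a.map f ++ l) l := by
  induction a with
  | nil => exact refl c s l
  | cons i a ih =>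
    exact (zero_cons (h i List.mem_cons_self) _).trans
      (ih fun j hj => h j (List.mem_cons_of_mem _ hj))

end ChainEquiv

/-- If `S` and `U` are the partial sums of a row before and after row insertion of `x`, then
`S ≤ U`. -/
theorem insertion_le {s : ℕ} {S U x : ℕ → ℝ} (hx : ∀ j < s, 0 ≤ x j) (h0 : S 0 = U 0)
    (hU : ∀ j < s, U (j + 1) = max (S (j + 1)) (U j) + x j) :
    ∀ j ≤ s, S j ≤ U j := by
  intro j hj
  cases j with
  | zero => exact h0.le
  | succ j =>
    have := hU j hj
    have := hx j hj
    have := le_max_left (S (j + 1)) (U j)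
    linarith

/-- Row insertion of `x` into a row with partial sums `S`, which yields a row with partial sums
`U` and a bumped row, preserves chains. -/
theorem chainEquiv_insertion {c s : ℕ} {S U x : ℕ → ℝ} (hS : ∀ j < s, S j ≤ S (j + 1))
    (hx : ∀ j < s, 0 ≤ x j) (h0 : S 0 = U 0)
    (hU : ∀ j < s, U (j + 1) = max (S (j + 1)) (U j) + x j) (l : List (ℕ → ℝ)) :
    ChainEquiv c s ((fun j => S (j + 1) - S j) :: x :: l)
      ((fun j => min (S (j + 1)) (U j) - S j) :: (fun j => U (j + 1) - U j) :: l) := by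
  have hSU := insertion_le hx h0 hU
  have hUx : ∀ j < s, x j ≠ 0 → U (j + 1) - U j ≠ 0 := by
    intro j hj h
    have h1 := hU j hj
    have h2 := lt_of_le_of_ne (hx j hj) h.symm
    have h3 := le_max_right (S (j + 1)) (U j)
    linarith
  -- Conservation: in each column the bumped row and the new row have the same total as the old row
  -- and `x`.
  have hmm : ∀ j, max (S (j + 1)) (U j) + min (S (j + 1)) (U j) = S (j + 1) + U j :=
    fun j => max_add_min _ _
  have hbS : ∀ j < s, min (S (j + 1)) (U j) - S j ≠ 0 → S (j + 1) - S j ≠ 0 := by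
    intro j hj h h'
    apply h
    rw [min_eq_left]
    · exact h'
    · have := hSU j hj.le
      linarith
  -- After the positive entry `x p` the sums `U` lie strictly above `S`. As long as nothing is
  -- bumped, `S` stays constant and the gap persists, so the next nonzero entry of the old row must
  -- be bumped.
  have hexists₁ : ∀ p q, p < q → q < s → x p ≠ 0 → S (q + 1) - S q ≠ 0 →
      ∃ q', p < q' ∧ q' ≤ q ∧ min (S (q' + 1)) (U q') - S q' ≠ 0 := by
    intro p q hpq hqs hxp hSq
    by_contra! hcon
    have key : ∀ e, p + 1 ≤ e → e ≤ q → S e < U e := by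
      intro e he
      induction e, he using Nat.le_induction with
      | base =>
        intro _
        have h1 := hU p (hpq.trans hqs)
        have h2 := lt_of_le_of_ne (hx p (hpq.trans hqs)) hxp.symm
        have h3 := le_max_left (S (p + 1)) (U p)
        linarith
      | succ e he ih =>
        intro heq
        have h1 := ih (by omega)
        have h2 := hcon e (by omega) (by omega)
        have h3 := hU e (by omega)
        have h4 := hx e (by omega)
        have h5 := le_max_right (S (e + 1)) (U e)
        rcases min_choice (S (e + 1)) (U e) with h | h <;> rw [h] at h2 <;> linarith
    have h1 := key q hpq le_rfl
    have h2 := hcon q hpq le_rfl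
    rcases min_choice (S (q + 1)) (U q) with h | h <;> rw [h] at h2
    · exact hSq h2
    · linarith
  -- If `x` vanished on `[p, q)`, then `U (p + 1) ≠ U p` would force `U (p + 1) = S (p + 1)`. From
  -- there on both sums would agree, so nothing could be bumped in column `q`.
  have hexists₂ : ∀ p q, p < q → q < s → U (p + 1) - U p ≠ 0 →
      min (S (q + 1)) (U q) - S q ≠ 0 → ∃ p', p ≤ p' ∧ p' < q ∧ x p' ≠ 0 := by
    intro p q hpq hqs hUp hq
    by_contra! hcon
    have key : ∀ e, p + 1 ≤ e → e ≤ q → U e = S e := by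
      intro e he
      induction e, he using Nat.le_induction with
      | base =>
        intro _
        have h1 := hU p (hpq.trans hqs)
        rw [hcon p le_rfl hpq, add_zero] at h1
        rcases max_choice (S (p + 1)) (U p) with h | h <;> rw [h] at h1
        · exact h1
        · exact absurd (sub_eq_zero.2 h1) hUp
      | succ e he ih =>
        intro heq
        rw [hU e (by omega), hcon e (by omega) (by omega), ih (by omega), add_zero,
          max_eq_left (hS e (by omega))]
    apply hq
    rw [key q hpq le_rfl, min_eq_right (hS q hqs), sub_self]
  -- A chain takes at most one entry from each of the two rows. Pairs are exchanged by the two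
  -- existence claims, single entries by conservation, and the chain in `l` is kept.
  intro d hd k
  constructor
  · rintro ((h | ⟨q, k', hk, hc, hq, hxq, h⟩) | ⟨q, k', hk, hc, hq, htq, h | ⟨p, k'', hk', hc', hp,
      hxp, h⟩⟩)
    · exact Or.inl (Or.inl h)
    · exact Or.inl (Or.inr ⟨q, k', hk, hc, hq, hUx q (hq.trans_le hd) hxq, h⟩)
    · by_cases hb : min (S (q + 1)) (U q) - S q = 0
      · refine Or.inl (Or.inr ⟨q, k', hk, hc, hq, fun h' => htq ?_, h⟩)
        have h1 := hU q (hq.trans_le hd)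
        have h2 := hx q (hq.trans_le hd)
        have h3 := hmm q
        have h4 := hS q (hq.trans_le hd)
        simp only at h' ⊢
        linarith
      · exact Or.inr ⟨q, k', hk, hc, hq, hb, Or.inl h⟩
    · obtain ⟨q', h1, h2, h3⟩ := hexists₁ p q hp (hq.trans_le hd) hxp htq
      exact Or.inr ⟨q', k', hk, by omega, by omega, h3, Or.inr ⟨p, k'', hk', hc', h1,
        hUx p (by omega) hxp, h⟩⟩
  · rintro ((h | ⟨q, k', hk, hc, hq, htq, h⟩) | ⟨q, k', hk, hc, hq, hbq, h | ⟨p, k'', hk', hc', hp,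
      htp, h⟩⟩)
    · exact Or.inl (Or.inl h)
    · by_cases hxq : x q = 0
      · refine Or.inr ⟨q, k', hk, hc, hq, fun h' => htq ?_, Or.inl h⟩
        have h1 := hU q (hq.trans_le hd)
        have h2 := hSU q (hq.le.trans hd)
        simp only at h' ⊢
        rw [hxq, max_eq_right (by linarith)] at h1
        linarith
      · exact Or.inl (Or.inr ⟨q, k', hk, hc, hq, hxq, h⟩)
    · exact Or.inr ⟨q, k', hk, hc, hq, hbS q (hq.trans_le hd) hbq, Or.inl h⟩
    · obtain ⟨p', h1, h2, h3⟩ := hexists₂ p q hp (hq.trans_le hd) htp hbq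
      exact Or.inr ⟨q, k', hk, hc, hq, hbS q (hq.trans_le hd) hbq,
        Or.inr ⟨p', k'', hk', hc'.trans h1, h2, h3, h.mono h1⟩⟩

theorem hasChain_map_shift {ι : Type*} {f g : ι → ℕ → ℝ} {a : List ι} {c s d k : ℕ}
    (h : ∀ i ∈ a, ∀ q < s, f i (q + 1) = g i q) (hd : d ≤ s) :
    HasChain (c + 1) (a.map f) (d + 1) k ↔ HasChain c (a.map g) d k := by
  induction a generalizing d k with
  | nil => exact Iff.rfl
  | cons i a ih =>
    have ih' : ∀ {d k}, d ≤ s → _ :=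
      fun {d k} hd => ih (d := d) (k := k) (fun j hj => h j (List.mem_cons_of_mem _ hj)) hd
    refine or_congr (ih' hd) ⟨?_, ?_⟩
    · rintro ⟨q, k', hk, hc, hq, hf, hl⟩
      obtain ⟨q, rfl⟩ : ∃ q', q = q' + 1 := ⟨q - 1, by omega⟩
      exact ⟨q, k', hk, by omega, by omega, h i List.mem_cons_self q (by omega) ▸ hf,
        (ih' (by omega)).1 hl⟩
    · rintro ⟨q, k', hk, hc, hq, hg, hl⟩
      exact ⟨q + 1, k', hk, by omega, by omega,
        (h i List.mem_cons_self q (by omega)).symm ▸ hg, (ih' (by omega)).2 hl⟩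

/-! ### The shapes of a matrix -/

/-- Last passage times: `lam x i j` is the largest weight of a chain in `[0, i) × [0, j)`. -/
noncomputable def lam (x : ℕ → ℕ → ℝ) : ℕ → ℕ → ℝ
  | 0, _ => 0
  | _ + 1, 0 => 0
  | i + 1, j + 1 => max (lam x i (j + 1)) (lam x (i + 1) j) + x i j

/-- The matrix of the entries bumped from the first row of the insertion tableau. -/
noncomputable def bump (x : ℕ → ℕ → ℝ) (i j : ℕ) : ℝ :=
  min (lam x i (j + 1)) (lam x (i + 1) j) - lam x i j

/-- `shape k x i j` is the `k`-th part, starting with `k = 0`, of the shape associated by RSK to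
the restriction of `x` to `[0, i) × [0, j)`. -/
noncomputable def shape (k : ℕ) (x : ℕ → ℕ → ℝ) : ℕ → ℕ → ℝ := lam (bump^[k] x)

section

variable {x : ℕ → ℕ → ℝ}

@[simp] theorem lam_zero_left (x : ℕ → ℕ → ℝ) (j : ℕ) : lam x 0 j = 0 := by rw [lam]

@[simp] theorem lam_zero_right (x : ℕ → ℕ → ℝ) (i : ℕ) : lam x i 0 = 0 := by
  cases i <;> rw [lam]

theorem lam_succ (x : ℕ → ℕ → ℝ) (i j : ℕ) :
    lam x (i + 1) (j + 1) = max (lam x i (j + 1)) (lam x (i + 1) j) + x i j := by rw [lam]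

theorem lam_transpose (x : ℕ → ℕ → ℝ) (i j : ℕ) : lam (fun i j => x j i) i j = lam x j i := by
  induction i generalizing j with
  | zero => simp
  | succ i ih =>
    induction j with
    | zero => simp
    | succ j ih' => rw [lam_succ, lam_succ, ih, ih', max_comm]

theorem bump_transpose (x : ℕ → ℕ → ℝ) : bump (fun i j => x j i) = fun i j => bump x j i := by
  funext i j
  simp only [bump, lam_transpose, min_comm]

theorem bump_iterate_transpose (k : ℕ) (x : ℕ → ℕ → ℝ) :
    bump^[k] (fun i j => x j i) = fun i j => bump^[k] x j i := by
  induction k generalizing x with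
  | zero => rfl
  | succ k ih => rw [Function.iterate_succ_apply, bump_transpose, ih, Function.iterate_succ_apply]

/-- The recursion and the bumping rule treat rows and columns alike. This symmetry of RSK lets
statements on the insertion tableau serve for the recording tableau. -/
theorem shape_transpose (k : ℕ) (x : ℕ → ℕ → ℝ) (i j : ℕ) :
    shape k (fun i j => x j i) i j = shape k x j i := by
  rw [shape, bump_iterate_transpose, lam_transpose, shape]

theorem lam_nonneg (hx : ∀ i j, 0 ≤ x i j) (i j : ℕ) : 0 ≤ lam x i j := by
  induction i generalizing j with
  | zero => simp
  | succ i ih =>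
    cases j with
    | zero => simp
    | succ j =>
      rw [lam_succ]
      exact add_nonneg ((ih _).trans (le_max_left _ _)) (hx i j)

theorem lam_le_succ_left (hx : ∀ i j, 0 ≤ x i j) (i j : ℕ) : lam x i j ≤ lam x (i + 1) j := by
  cases j with
  | zero => simp
  | succ j =>
    rw [lam_succ]
    exact (le_max_left _ _).trans (le_add_of_nonneg_right (hx i j))

theorem lam_le_succ_right (hx : ∀ i j, 0 ≤ x i j) (i j : ℕ) : lam x i j ≤ lam x i (j + 1) := by
  rw [← lam_transpose, ← lam_transpose x (j + 1)]
  exact lam_le_succ_left (fun i j => hx j i) j i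

theorem bump_nonneg (hx : ∀ i j, 0 ≤ x i j) (i j : ℕ) : 0 ≤ bump x i j :=
  sub_nonneg.2 (le_min (lam_le_succ_right hx i j) (lam_le_succ_left hx i j))

theorem bump_iterate_nonneg (hx : ∀ i j, 0 ≤ x i j) (k i j : ℕ) : 0 ≤ bump^[k] x i j := by
  induction k generalizing i j with
  | zero => exact hx i j
  | succ k ih => rw [Function.iterate_succ_apply']; exact bump_nonneg ih i j

theorem shape_nonneg (hx : ∀ i j, 0 ≤ x i j) (k i j : ℕ) : 0 ≤ shape k x i j :=
  lam_nonneg (bump_iterate_nonneg hx k) i j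

/-- The local rule for shapes. Read as an equation for the part `k + 1` in terms of the part `k`, it
is a piecewise-linear toggle; this links `shape` to `RSK`. -/
theorem shape_succ_succ (k : ℕ) (x : ℕ → ℕ → ℝ) (i j : ℕ) :
    shape (k + 1) x (i + 1) (j + 1) =
      max (shape (k + 1) x i (j + 1)) (shape (k + 1) x (i + 1) j) +
        (min (shape k x i (j + 1)) (shape k x (i + 1) j) - shape k x i j) := by
  simp only [shape]
  rw [lam_succ, Function.iterate_succ_apply']
  rfl

theorem lam_eq_zero {n : ℕ} (h : ∀ i < n, ∀ j, x i j = 0) :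
    ∀ i ≤ n, ∀ j, lam x i j = 0 := by
  intro i
  induction i with
  | zero => simp
  | succ i ih =>
    intro hi j
    induction j with
    | zero => simp
    | succ j ihj => rw [lam_succ, ih (by omega), ihj, h i (by omega)]; simp

/-- Row `k` of the tableau receives nothing from the first `k` rows of the matrix: inserting into an
empty row bumps nothing, so each round of bumping clears one further row. -/
theorem bump_iterate_eq_zero (hx : ∀ i j, 0 ≤ x i j) (k : ℕ) :
    ∀ i < k, ∀ j, bump^[k] x i j = 0 := by
  induction k with
  | zero => simp
  | succ k ih =>
    intro i hi j
    have h := lam_eq_zero ih i (by omega)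
    rw [Function.iterate_succ_apply', bump, h, h, sub_zero]
    exact min_eq_left (lam_nonneg (bump_iterate_nonneg hx k) _ _)

theorem shape_eq_zero_left (hx : ∀ i j, 0 ≤ x i j) {k i : ℕ} (h : i ≤ k) (j : ℕ) :
    shape k x i j = 0 :=
  lam_eq_zero (bump_iterate_eq_zero hx k) i h j

theorem shape_eq_zero_right (hx : ∀ i j, 0 ≤ x i j) {k j : ℕ} (h : j ≤ k) (i : ℕ) :
    shape k x i j = 0 := by
  rw [← shape_transpose]
  exact shape_eq_zero_left (fun i j => hx j i) h i

/-- The `k`-th row of the insertion tableau of the first `r` rows of `x`. -/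
noncomputable def tableauRow (x : ℕ → ℕ → ℝ) (r k j : ℕ) : ℝ :=
  shape k x r (j + 1) - shape k x r j

/-- The first tableau row travels down the list. Each matrix row it meets is inserted into it and
leaves the bumped row behind, above it. -/
theorem chainEquiv_insert_rows (hx : ∀ i j, 0 ≤ x i j) (c s i n : ℕ) (m : List (ℕ → ℝ)) :
    ChainEquiv c s
      ((fun j => lam x i (j + 1) - lam x i j) :: ((List.range' i n).map x ++ m))
      ((List.range' i n).map (bump x) ++
        ((fun j => lam x (i + n) (j + 1) - lam x (i + n) j) :: m)) := by
  induction n generalizing i with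
  | zero => exact ChainEquiv.refl _ _ _
  | succ n ih =>
    have h1 : i + (n + 1) = i + 1 + n := by omega
    rw [List.range'_succ, h1]
    refine (chainEquiv_insertion (U := lam x (i + 1)) (fun j _ => lam_le_succ_right hx i j)
      (fun j _ => hx i j) (by simp) (fun j _ => lam_succ x i j) _).trans ?_
    exact (ih (i + 1)).cons _

/-- Repeated bumping peels off one tableau row at a time, and after `r` rounds no matrix row is
left. The tableau is read from its last row to its first, as in a row reading word. -/
theorem chainEquiv_tableau (hx : ∀ i j, 0 ≤ x i j) (c s r : ℕ) :
    ChainEquiv c s ((List.range r).map x) ((List.range r).reverse.map (tableauRow x r)) := by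
  have key : ∀ n, ChainEquiv c s ((List.range r).map x)
      ((List.range r).map (bump^[n] x) ++ (List.range n).reverse.map (tableauRow x r)) := by
    intro n
    induction n with
    | zero => simpa using ChainEquiv.refl c s _
    | succ n ih =>
      -- The insertion of each round starts from an empty row, which is added in front of the list
      -- at no cost.
      refine ih.trans ((ChainEquiv.zero_cons (x := fun j => lam (bump^[n] x) 0 (j + 1) -
        lam (bump^[n] x) 0 j) (by simp) _).symm.trans ?_)
      have := chainEquiv_insert_rows (bump_iterate_nonneg hx n) c s 0 r
        ((List.range n).reverse.map (tableauRow x r))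
      rw [← List.range_eq_range', zero_add] at this
      rw [Function.iterate_succ', List.range_succ, List.reverse_append]
      exact this
  refine (key r).trans (ChainEquiv.zero_map_append (fun i hi q _ _ => ?_) _)
  exact bump_iterate_eq_zero hx r i (List.mem_range.1 hi) q

end

/-- The chains of a matrix in column intervals are determined by its insertion tableau. -/
theorem chainEquiv_of_shape_eq {x y : ℕ → ℕ → ℝ} (hx : ∀ i j, 0 ≤ x i j) (hy : ∀ i j, 0 ≤ y i j)
    {r s : ℕ} (h : ∀ k < r, ∀ j ≤ s, shape k x r j = shape k y r j) (c : ℕ) :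
    ChainEquiv c s ((List.range r).map x) ((List.range r).map y) := by
  refine (chainEquiv_tableau hx c s r).trans
    (ChainEquiv.trans (ChainEquiv.map_congr ?_) (chainEquiv_tableau hy c s r).symm)
  intro k hk q _ hq
  have hk' : k < r := by simpa using hk
  rw [tableauRow, tableauRow, h k hk' _ hq, h k hk' _ hq.le]

/-- The recurrence by which promotion of tableaux acts on shapes. -/
def IsPromotion (r s : ℕ) (x y : ℕ → ℕ → ℝ) : Prop :=
  ∀ k < r, ∀ c, c + 1 < s →
    shape k y r (c + 1) + shape k x r (c + 1) =
      (if k = 0 then shape 0 x r (c + 2) else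
        min (shape (k - 1) y r c) (shape k x r (c + 2))) +
      max (shape (k + 1) x r (c + 2)) (shape k y r c)

/-- Promotion of the insertion tableau deletes the first column and shifts the others. -/
theorem hasChain_iff_of_isPromotion {x y : ℕ → ℕ → ℝ} (hx : ∀ i j, 0 ≤ x i j)
    (hy : ∀ i j, 0 ≤ y i j) {r s : ℕ} (h : IsPromotion r s x y) {c d k : ℕ} (hd : d + 1 ≤ s) :
    HasChain (c + 1) ((List.range r).map x) (d + 1) k ↔
      HasChain c ((List.range r).map y) d k := by
  -- `u k` holds the partial sums of row `k` of the promoted tableau, moved one column to the right.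
  -- `X k` is the row to be inserted into row `k + 1` of the old tableau: `X 0` is its first row
  -- with column `0` erased, and `X (k + 1)` is what `X k` bumps.
  let u : ℕ → ℕ → ℝ := fun k j => shape k y r (j - 1)
  let X : ℕ → ℕ → ℝ := fun k j => if j = 0 then 0 else
    (if k = 0 then shape 0 x r (j + 1) else
      min (shape (k - 1) y r (j - 1)) (shape k x r (j + 1))) - shape k x r j
  -- The promotion recurrence is precisely row insertion of `X k` into row `k + 1`, with result `u
  -- k`.
  have hrec : ∀ k < r, ∀ j < s, u k (j + 1) = max (shape (k + 1) x r (j + 1)) (u k j) + X k j := by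
    intro k hk j hj
    cases j with
    | zero => simp [u, X, shape_eq_zero_right hx, shape_eq_zero_right hy]
    | succ j =>
      have := h k hk j hj
      simp only [u, X, Nat.add_sub_cancel, if_neg (Nat.succ_ne_zero j)]
      linarith
  have hbump : ∀ k, ∀ q, 1 ≤ q →
      min (shape (k + 1) x r (q + 1)) (u k q) - shape (k + 1) x r q = X (k + 1) q := by
    intro k q hq
    simp [u, X, min_comm, Nat.pos_iff_ne_zero.1 hq]
  have key : ∀ n ≤ r, (∀ j < s, 0 ≤ X n j) ∧
      ChainEquiv (c + 1) s ((List.range n).reverse.map (fun k => tableauRow x r (k + 1)) ++ [X 0])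
        (X n :: (List.range n).reverse.map (fun k j => u k (j + 1) - u k j)) := by
    intro n
    induction n with
    | zero =>
      intro _
      refine ⟨fun j _ => ?_, ChainEquiv.refl _ _ _⟩
      simp only [X]
      split_ifs
      · exact le_rfl
      · exact sub_nonneg.2 (lam_le_succ_right (bump_iterate_nonneg hx 0) r j)
    | succ n ih =>
      intro hn
      obtain ⟨ih1, ih2⟩ := ih (by omega)
      have h0 : shape (n + 1) x r 0 = u n 0 := by
        simp [u, shape_eq_zero_right hx, shape_eq_zero_right hy]
      have hmono : ∀ j < s, shape (n + 1) x r j ≤ shape (n + 1) x r (j + 1) :=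
        fun j _ => lam_le_succ_right (bump_iterate_nonneg hx (n + 1)) r j
      constructor
      · intro j hj
        rcases Nat.eq_zero_or_pos j with rfl | hj0
        · simp [X]
        · rw [← hbump n j hj0, sub_nonneg]
          exact le_min (hmono j hj) (insertion_le ih1 h0 (hrec n (by omega)) j hj.le)
      · rw [List.range_succ, List.reverse_append]
        refine (ih2.cons _).trans ?_
        refine (chainEquiv_insertion hmono ih1 h0 (hrec n (by omega)) _).trans ?_
        exact ChainEquiv.cons_congr (fun q hq _ => hbump n q (by omega)) (ChainEquiv.refl _ _ _)
  -- Row `r` of the old tableau is empty, so the last insertion bumps nothing.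
  have hlast : ∀ q, c + 1 ≤ q → q < s → X r q = 0 := by
    intro q hq _
    have hr0 : ∀ j, shape r x r j = 0 := shape_eq_zero_left hx le_rfl
    simp only [X, hr0]
    rw [if_neg (by omega), sub_zero]
    split_ifs with h0
    · subst h0; exact hr0 _
    · exact min_eq_right (shape_nonneg hy _ _ _)
  have hmain : ChainEquiv (c + 1) s ((List.range r).map x)
      ((List.range r).reverse.map (fun k j => u k (j + 1) - u k j)) := by
    refine (chainEquiv_tableau hx (c + 1) s r).trans ?_
    refine ChainEquiv.trans (ChainEquiv.symm ?_) ((key r le_rfl).2.trans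
      (ChainEquiv.zero_cons hlast _))
    cases r with
    | zero =>
      refine ChainEquiv.zero_cons hlast _
    | succ n =>
      have h1 : (List.range (n + 1)).reverse.map (fun k => tableauRow x (n + 1) (k + 1)) ++ [X 0] =
          tableauRow x (n + 1) (n + 1) ::
            ((List.range n).reverse.map (fun k => tableauRow x (n + 1) (k + 1)) ++ [X 0]) := by
        rw [List.range_succ, List.reverse_append]; rfl
      have h2 : (List.range (n + 1)).reverse.map (tableauRow x (n + 1)) =
          (List.range n).reverse.map (fun k => tableauRow x (n + 1) (k + 1)) ++
            [tableauRow x (n + 1) 0] := by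
        rw [List.range_succ_eq_map, List.reverse_cons, List.map_append, ← List.map_reverse,
          List.map_map]
        rfl
      rw [h1, h2]
      refine (ChainEquiv.zero_cons (fun q _ _ => ?_) _).trans ?_
      · simp [tableauRow, shape_eq_zero_left hx]
      · have : ∀ l : List ℕ, ChainEquiv (c + 1) s
            (l.map (fun k => tableauRow x (n + 1) (k + 1)) ++ [X 0])
            (l.map (fun k => tableauRow x (n + 1) (k + 1)) ++ [tableauRow x (n + 1) 0]) := by
          intro l
          induction l with
          | nil =>
            -- `X 0` and the first tableau row differ only in column `0`, outside of the interval
            -- considered.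
            refine ChainEquiv.cons_congr (fun q hq _ => ?_) (ChainEquiv.refl _ _ _)
            simp only [X, tableauRow]
            simp [if_neg (show q ≠ 0 by omega)]
          | cons a l ih => exact ih.cons _
        exact this _
  rw [hmain (d + 1) hd k, hasChain_map_shift (s := d) (g := tableauRow y r) ?_ le_rfl]
  · exact (chainEquiv_tableau hy c d r d le_rfl k).symm
  · intro i _ q _
    simp [u, tableauRow]

/-! ### Strict southeast chains in boxes of the plane -/

/-- The box `[i₁, i₂) × [j₁, j₂)` contains an antichain of size `k` on which `f` does not
vanish. -/
def HasSE (f : ℤ × ℤ → ℝ) (i₁ i₂ j₁ j₂ : ℤ) (k : ℕ) : Prop :=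
  ∃ A : Finset (ℤ × ℤ), A.card = k ∧ IsAntichain (· ≤ ·) (A : Set (ℤ × ℤ)) ∧
    ∀ p ∈ A, i₁ ≤ p.1 ∧ p.1 < i₂ ∧ j₁ ≤ p.2 ∧ p.2 < j₂ ∧ f p ≠ 0

theorem isAntichain_swap {A : Finset (ℤ × ℤ)} (h : IsAntichain (· ≤ ·) (A : Set (ℤ × ℤ))) :
    IsAntichain (· ≤ ·)
      ((A.map (Equiv.prodComm ℤ ℤ).toEmbedding : Finset (ℤ × ℤ)) : Set (ℤ × ℤ)) := by
  intro p hp q hq hpq hle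
  simp only [Finset.coe_map, Set.mem_image, Finset.mem_coe] at hp hq
  obtain ⟨p, hp, rfl⟩ := hp
  obtain ⟨q, hq, rfl⟩ := hq
  exact h hp hq (fun h' => hpq (by rw [h'])) ⟨hle.2, hle.1⟩

theorem HasSE.swap {f : ℤ × ℤ → ℝ} {i₁ i₂ j₁ j₂ : ℤ} {k : ℕ} (h : HasSE f i₁ i₂ j₁ j₂ k) :
    HasSE (fun p => f p.swap) j₁ j₂ i₁ i₂ k := by
  obtain ⟨A, hk, hA, h⟩ := h
  refine ⟨A.map (Equiv.prodComm ℤ ℤ).toEmbedding, by simpa using hk, isAntichain_swap hA, ?_⟩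
  intro p hp
  obtain ⟨q, hq, rfl⟩ := Finset.mem_map.1 hp
  obtain ⟨h1, h2, h3, h4, h5⟩ := h q hq
  exact ⟨h3, h4, h1, h2, h5⟩

theorem hasSE_swap {f : ℤ × ℤ → ℝ} {i₁ i₂ j₁ j₂ : ℤ} {k : ℕ} :
    HasSE (fun p => f p.swap) j₁ j₂ i₁ i₂ k ↔ HasSE f i₁ i₂ j₁ j₂ k :=
  ⟨fun h => h.swap, HasSE.swap⟩

/-- An antichain has at most one box in each row, and its columns strictly decrease as the row
grows. So a box in the first row bounds the columns of all the others. -/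
theorem hasChain_iff_hasSE (f : ℤ × ℤ → ℝ) (a c : ℤ) (i n j₁ j₂ k : ℕ) :
    HasChain j₁ ((List.range' i n).map fun (i j : ℕ) => f (a + (i : ℤ), c + (j : ℤ))) j₂ k ↔
      HasSE f (a + i) (a + i + n) (c + j₁) (c + j₂) k := by
  induction n generalizing i j₂ k with
  | zero =>
    constructor
    · intro h
      have : k = 0 := h
      exact ⟨∅, by simp [this], by simp, by simp⟩
    · rintro ⟨A, hk, -, h⟩
      have : A = ∅ := by
        refine Finset.eq_empty_of_forall_notMem fun p hp => ?_
        have := h p hp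
        push_cast at this
        omega
      subst this
      exact hk.symm
  | succ n ih =>
    rw [List.range'_succ, List.map_cons]
    constructor
    · rintro (h | ⟨q, k', rfl, h1, h2, h3, h⟩)
      · obtain ⟨A, hk, hA, h⟩ := (ih _ _ _).1 h
        refine ⟨A, hk, hA, fun p hp => ?_⟩
        obtain ⟨h1, h2, h3, h4, h5⟩ := h p hp
        push_cast at *
        exact ⟨by omega, by omega, h3, h4, h5⟩
      · obtain ⟨A, hk, hA, h⟩ := (ih _ _ _).1 h
        have hnot : (a + (i : ℤ), c + (q : ℤ)) ∉ A := by
          intro hp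
          have := h _ hp
          push_cast at this
          omega
        refine ⟨insert (a + (i : ℤ), c + (q : ℤ)) A, by rw [Finset.card_insert_of_notMem hnot, hk],
          ?_, ?_⟩
        · rw [Finset.coe_insert]
          refine hA.insert (fun p hp _ hle => ?_) (fun p hp _ hle => ?_)
          all_goals
            have := h p hp
            have := hle.1
            have := hle.2
            push_cast at *
            omega
        · intro p hp
          rcases Finset.mem_insert.1 hp with rfl | hp
          · push_cast
            exact ⟨by omega, by omega, by omega, by omega, h3⟩
          · obtain ⟨h1, h2, h3, h4, h5⟩ := h p hp
            push_cast at *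
            exact ⟨by omega, by omega, by omega, by omega, h5⟩
    · rintro ⟨A, rfl, hA, h⟩
      by_cases hex : ∃ p ∈ A, p.1 = a + i
      · obtain ⟨p, hp, hpi⟩ := hex
        obtain ⟨h1, h2, h3, h4, h5⟩ := h p hp
        refine Or.inr ⟨(p.2 - c).toNat, (A.erase p).card, ?_, by omega, by omega, ?_, ?_⟩
        · rw [Finset.card_erase_add_one hp]
        · have : (a + (i : ℤ), c + ((p.2 - c).toNat : ℤ)) = p :=
            Prod.ext hpi.symm (by simp only; omega)
          simpa only [this] using h5
        · refine (ih _ _ _).2 ⟨A.erase p, rfl, hA.subset (by simp), fun q hq => ?_⟩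
          obtain ⟨hqp, hq⟩ := Finset.mem_erase.1 hq
          obtain ⟨h1', h2', h3', h4', h5'⟩ := h q hq
          have hn1 : ¬ (p.1 ≤ q.1 ∧ p.2 ≤ q.2) := fun hle => hA hp hq hqp.symm hle
          have hn2 : ¬ (q.1 ≤ p.1 ∧ q.2 ≤ p.2) := fun hle => hA hq hp hqp hle
          push_cast at *
          exact ⟨by omega, by omega, by omega, by omega, h5'⟩
      · refine Or.inl ((ih _ _ _).2 ⟨A, rfl, hA, fun p hp => ?_⟩)
        obtain ⟨h1, h2, h3, h4, h5⟩ := h p hp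
        have : p.1 ≠ a + i := fun h' => hex ⟨p, hp, h'⟩
        push_cast at *
        exact ⟨by omega, by omega, by omega, by omega, h5⟩

theorem hasSE_iff_hasChain {f : ℤ × ℤ → ℝ} {x : ℕ → ℕ → ℝ} {a c : ℤ} {r s : ℕ}
    (hf : ∀ i < r, ∀ j < s, f (a + (i : ℤ), c + (j : ℤ)) = x i j) {j₁ j₂ : ℕ} (hj : j₂ ≤ s)
    (k : ℕ) :
    HasSE f a (a + r) (c + j₁) (c + j₂) k ↔ HasChain j₁ ((List.range r).map x) j₂ k := by
  have h1 := hasChain_iff_hasSE f a c 0 r j₁ j₂ k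
  rw [← List.range_eq_range', Nat.cast_zero, add_zero] at h1
  rw [← h1]
  refine ChainEquiv.map_congr (s := s) (fun i hi q _ hq => ?_) j₂ hj k
  exact hf i (List.mem_range.1 hi) q hq

/-- The effect on chains of promotion in a rectangle: chains in the intervals of rows keep their
sizes, and chains in the intervals of columns avoiding the first column are shifted by one. -/
structure ShiftsChains (f g : ℤ × ℤ → ℝ) (a c : ℤ) (r s : ℕ) : Prop where
  rows : ∀ i₁ i₂ k, a ≤ i₁ → i₁ ≤ a + r → a ≤ i₂ → i₂ ≤ a + r →
    (HasSE f i₁ i₂ c (c + s) k ↔ HasSE g i₁ i₂ c (c + s) k)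
  columns : ∀ j₁ j₂ k, c + 1 ≤ j₁ → j₁ ≤ c + s → c + 1 ≤ j₂ → j₂ ≤ c + s →
    (HasSE f a (a + r) j₁ j₂ k ↔ HasSE g a (a + r) (j₁ - 1) (j₂ - 1) k)

/-- Intervals of rows are handled on the transposed matrices, whose insertion tableaux are encoded
by the shapes of `[i] × [s]`; intervals of columns come from promotion. -/
theorem shiftsChains_of_isPromotion {x y : ℕ → ℕ → ℝ} (hx : ∀ i j, 0 ≤ x i j)
    (hy : ∀ i j, 0 ≤ y i j) {r s : ℕ} (h : IsPromotion r s x y)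
    (h' : ∀ k < s, ∀ i ≤ r, shape k x i s = shape k y i s)
    {f g : ℤ × ℤ → ℝ} {a c : ℤ}
    (hf : ∀ i < r, ∀ j < s, f (a + (i : ℤ), c + (j : ℤ)) = x i j)
    (hg : ∀ i < r, ∀ j < s, g (a + (i : ℤ), c + (j : ℤ)) = y i j) :
    ShiftsChains f g a c r s := by
  constructor
  · intro i₁ i₂ k h1 h2 h3 h4
    lift i₁ - a to ℕ using by omega with n₁ hn₁
    lift i₂ - a to ℕ using by omega with n₂ hn₂
    obtain rfl : i₁ = a + n₁ := by omega
    obtain rfl : i₂ = a + n₂ := by omega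
    rw [← hasSE_swap, ← hasSE_swap (f := g),
      hasSE_iff_hasChain (x := fun j i => x i j) (s := r) (fun j hj i hi => hf i hi j hj)
        (by omega),
      hasSE_iff_hasChain (x := fun j i => y i j) (s := r) (fun j hj i hi => hg i hi j hj)
        (by omega)]
    refine chainEquiv_of_shape_eq (fun j i => hx i j) (fun j i => hy i j) (s := r) ?_ n₁ n₂
      (by omega) k
    intro k hk i hi
    exact (shape_transpose k x s i).trans ((h' k hk i hi).trans (shape_transpose k y s i).symm)
  · intro j₁ j₂ k h1 h2 h3 h4
    lift j₁ - c - 1 to ℕ using by omega with n₁ hn₁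
    lift j₂ - c - 1 to ℕ using by omega with n₂ hn₂
    obtain rfl : j₁ = c + ((n₁ + 1 : ℕ) : ℤ) := by push_cast; omega
    obtain rfl : j₂ = c + ((n₂ + 1 : ℕ) : ℤ) := by push_cast; omega
    have e₁ : c + ((n₁ + 1 : ℕ) : ℤ) - 1 = c + (n₁ : ℤ) := by push_cast; ring
    have e₂ : c + ((n₂ + 1 : ℕ) : ℤ) - 1 = c + (n₂ : ℤ) := by push_cast; ring
    rw [e₁, e₂, hasSE_iff_hasChain hf (by omega), hasSE_iff_hasChain hg (by omega)]
    exact hasChain_iff_of_isPromotion hx hy h (by omega)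

/-! ### Compositions of toggles -/

section Toggles

variable {P : Type*} [PartialOrder P] [Fintype P]

theorem mem_lowerCovers {p q : P} : q ∈ lowerCovers p ↔ q ⋖ p := by
  classical
  simp [lowerCovers]

theorem mem_upperCovers {p q : P} : q ∈ upperCovers p ↔ p ⋖ q := by
  classical
  simp [upperCovers]

theorem minAbove_congr' {x y : P → ℝ} {p : P} (h : ∀ q, p ⋖ q → x q = y q) :
    minAbove x p = minAbove y p := by
  unfold minAbove
  split_ifs with hne
  · exact Finset.inf'_congr hne rfl (fun q hq => h q (mem_upperCovers.1 hq))
  · rfl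

theorem minAbove_eq {x : P → ℝ} {p : P} {v : ℝ} (h : ∀ q, p ⋖ q → v ≤ x q)
    (h' : ∃ q, p ⋖ q ∧ x q = v) : minAbove x p = v := by
  obtain ⟨q, hq, rfl⟩ := h'
  have hq' := mem_upperCovers.2 hq
  rw [minAbove, dif_pos ⟨q, hq'⟩]
  exact le_antisymm (Finset.inf'_le _ hq')
    (Finset.le_inf' _ _ fun q hq => h q (mem_upperCovers.1 hq))

theorem maxBelow_eq {x : P → ℝ} {p : P} {v : ℝ} (h : ∀ q, q ⋖ p → x q ≤ v)
    (h' : (∃ q, q ⋖ p ∧ x q = v) ∨ ((∀ q, ¬ q ⋖ p) ∧ v = 0)) : maxBelow x p = v := by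
  rcases h' with ⟨q, hq, rfl⟩ | ⟨hn, rfl⟩
  · have hq' := mem_lowerCovers.2 hq
    rw [maxBelow, dif_pos ⟨q, hq'⟩]
    exact le_antisymm (Finset.sup'_le _ _ fun q hq => h q (mem_lowerCovers.1 hq))
      (Finset.le_sup' _ hq')
  · rw [maxBelow, dif_neg]
    rintro ⟨q, hq⟩
    exact hn q (mem_lowerCovers.1 hq)

theorem toggle_apply_self (p : P) (x : P → ℝ) :
    toggle p x p = minAbove x p + maxBelow x p - x p := by
  classical
  change toggleFun p x p = _
  exact Function.update_self _ _ _

theorem toggle_apply_of_ne {p q : P} (h : q ≠ p) (x : P → ℝ) : toggle p x q = x q := by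
  classical
  change toggleFun p x q = _
  exact Function.update_of_ne h _ _

theorem toggle_inv (p : P) : (toggle p)⁻¹ = toggle p := rfl

/-- Toggling along a list which is a linear extension, from the bottom to the top. -/
theorem toggles_inv_apply {l : List P} (hl : l.Nodup) (hl' : l.Pairwise fun a b => ¬ b < a)
    (x : P → ℝ) :
    (∀ p ∉ l, ((l.map toggle).prod)⁻¹ x p = x p) ∧
      ∀ p ∈ l, ((l.map toggle).prod)⁻¹ x p =
        minAbove x p + maxBelow (((l.map toggle).prod)⁻¹ x) p - x p := by
  induction l generalizing x with
  | nil => simp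
  | cons a l ih =>
    obtain ⟨ha, hl⟩ := List.nodup_cons.1 hl
    obtain ⟨ha', hl'⟩ := List.pairwise_cons.1 hl'
    obtain ⟨ih1, ih2⟩ := ih hl hl' (toggle a x)
    rw [List.map_cons, List.prod_cons, mul_inv_rev, Equiv.Perm.mul_apply, toggle_inv]
    refine ⟨fun p hp => ?_, fun p hp => ?_⟩
    · rw [List.mem_cons, not_or] at hp
      rw [ih1 p hp.2, toggle_apply_of_ne hp.1]
    · rcases List.mem_cons.1 hp with rfl | hp'
      · rw [ih1 p ha, toggle_apply_self]
        congr 2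
        refine maxBelow_congr fun q hq => ?_
        rw [ih1 q fun h => ha' q h hq, toggle_apply_of_ne hq.ne]
      · have hpa : p ≠ a := by rintro rfl; exact ha hp'
        rw [ih2 p hp', toggle_apply_of_ne hpa]
        congr 2
        refine minAbove_congr fun q hq => toggle_apply_of_ne ?_ x
        rintro rfl
        exact ha' p hp' hq

/-- The permutations of `ℝ^P` that preserve the cone of nonnegative order-preserving labelings
together with its complement. -/
def conePreserving (P : Type*) [PartialOrder P] [Fintype P] :
    Subgroup (Equiv.Perm (P → ℝ)) where
  carrier := {e | ∀ x, (∀ p, maxBelow x p ≤ x p) ↔ ∀ p, maxBelow (e x) p ≤ e x p}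
  mul_mem' ha hb x := (hb x).trans (ha _)
  one_mem' _ := Iff.rfl
  inv_mem' {e} he x := by
    have := he (e⁻¹ x)
    rw [show e (e⁻¹ x) = x from e.apply_symm_apply x] at this
    exact this.symm

/-- The toggle reflects `x p` in the interval from `maxBelow x p` to `minAbove x p`. For a maximal
`p` the upper end would be the constant `1`, which may be smaller than `x p`; hence the hypothesis
on `p`. -/
theorem maxBelow_toggle_le {p : P} (hp : ∃ q, p ⋖ q) {x : P → ℝ}
    (hx : ∀ q, maxBelow x q ≤ x q) (q : P) : maxBelow (toggle p x) q ≤ toggle p x q := by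
  have hcov : ∀ a b, a ⋖ b → x a ≤ x b := by
    intro a b hab
    refine le_trans ?_ (hx b)
    have hab' := mem_lowerCovers.2 hab
    rw [maxBelow, dif_pos ⟨a, hab'⟩]
    exact Finset.le_sup' x hab'
  have hmin : ∀ b, p ⋖ b → minAbove x p ≤ x b := by
    intro b hb
    have hb' := mem_upperCovers.2 hb
    rw [minAbove, dif_pos ⟨b, hb'⟩]
    exact Finset.inf'_le x hb'
  have hmin' : x p ≤ minAbove x p := by
    obtain ⟨b, hb⟩ := hp
    rw [minAbove, dif_pos ⟨b, mem_upperCovers.2 hb⟩]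
    exact Finset.le_inf' _ _ fun q hq => hcov p q (mem_upperCovers.1 hq)
  by_cases hqp : q = p
  · subst hqp
    rw [toggle_apply_self, maxBelow_congr (fun a ha => toggle_apply_of_ne ha.ne x)]
    linarith
  · rw [toggle_apply_of_ne hqp]
    have hq := hx q
    unfold maxBelow at hq ⊢
    split_ifs at hq ⊢ with h
    · refine Finset.sup'_le _ _ fun a ha => ?_
      have ha' := mem_lowerCovers.1 ha
      by_cases hap : a = p
      · subst hap
        rw [toggle_apply_self]
        linarith [hx a, hmin q ha']
      · rw [toggle_apply_of_ne hap]
        exact hcov a q ha'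
    · exact hq

theorem toggle_mem_conePreserving {p : P} (hp : ∃ q, p ⋖ q) : toggle p ∈ conePreserving P := by
  intro x
  refine ⟨maxBelow_toggle_le hp, fun h => ?_⟩
  have := maxBelow_toggle_le hp h
  rwa [show toggle p (toggle p x) = x from toggleFun_involutive p x] at this

/-- The inverse of the transfer map carries the nonnegative labelings onto the cone that the toggles
preserve. -/
theorem transfer_nonneg_iff (x : P → ℝ) :
    (∀ p, 0 ≤ transfer x p) ↔ ∀ p, maxBelow x p ≤ x p :=
  forall_congr' fun _ => sub_nonneg

theorem transfer_inv_apply (x : P → ℝ) (p : P) :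
    transfer⁻¹ x p = x p + maxBelow (transfer⁻¹ x) p :=
  transferInv_eq x p

end Toggles

/-! ### Toggles in a rectangle -/

section Rectangle

variable {r s : ℕ}

theorem prod_covBy_iff {p q : Fin r × Fin s} :
    p ⋖ q ↔ (p.1.val + 1 = q.1.val ∧ p.2 = q.2) ∨ (p.2.val + 1 = q.2.val ∧ p.1 = q.1) := by
  have h : ∀ {n : ℕ} {a b : Fin n}, a ⋖ b ↔ a.val + 1 = b.val := by
    intro n a b
    rw [Fin.covBy_iff, Nat.covBy_iff_add_one_eq]
  rw [Prod.covBy_iff, h, h]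

theorem pairwise_product : (List.finRange r ×ˢ List.finRange s).Pairwise fun a b => ¬ b < a := by
  change ((List.finRange r).flatMap fun a => (List.finRange s).map (Prod.mk a)).Pairwise _
  rw [List.pairwise_flatMap]
  refine ⟨fun a _ => List.pairwise_map.2 ((List.pairwise_lt_finRange s).imp fun h h' => ?_),
    (List.pairwise_lt_finRange r).imp fun h x hx y hy h' => ?_⟩
  · exact absurd h'.le.2 (not_le.2 h)
  · obtain ⟨j, -, rfl⟩ := List.mem_map.1 hx
    obtain ⟨k, -, rfl⟩ := List.mem_map.1 hy
    exact absurd h'.le.1 (not_le.2 h)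

theorem mem_file {k : ℤ} {p : Fin r × Fin s} :
    p ∈ file r s k ↔ (p.1.val : ℤ) - p.2.val = k := by
  simp [file]

theorem mem_ideal {i j : ℕ} {p : Fin r × Fin s} :
    p ∈ ideal r s i j ↔ p.1.val < i ∧ p.2.val < j := by
  simp [ideal]

theorem rowmotion_inv_apply (I : Finset (Fin r × Fin s)) (x : Fin r × Fin s → ℝ) :
    (∀ p ∉ I, (rowmotion r s I)⁻¹ x p = x p) ∧
      ∀ p ∈ I, (rowmotion r s I)⁻¹ x p =
        minAbove x p + maxBelow ((rowmotion r s I)⁻¹ x) p - x p := by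
  have h := toggles_inv_apply (l := (List.finRange r ×ˢ List.finRange s).filter (fun p => p ∈ I))
    (((List.nodup_finRange r).product (List.nodup_finRange s)).filter _)
    (pairwise_product.filter _) x
  simpa [rowmotion, List.mem_filter] using h

theorem rowmotion_mem_conePreserving {I : Finset (Fin r × Fin s)} (h : ∀ p ∈ I, ∃ q, p ⋖ q) :
    rowmotion r s I ∈ conePreserving (Fin r × Fin s) := by
  refine Subgroup.list_prod_mem _ fun e he => ?_
  obtain ⟨p, hp, rfl⟩ := List.mem_map.1 he
  exact toggle_mem_conePreserving (h p (by simpa using (List.mem_filter.1 hp).2))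

/-- Covers change the file, so the toggles within one file do not influence each other and act
simultaneously. -/
theorem rowmotion_file_apply (k : ℤ) (x : Fin r × Fin s → ℝ) (p : Fin r × Fin s) :
    (((p.1.val : ℤ) - p.2.val ≠ k) → rowmotion r s (file r s k) x p = x p) ∧
      ((p.1.val : ℤ) - p.2.val = k → rowmotion r s (file r s k) x p =
        minAbove x p + maxBelow x p - x p) := by
  obtain ⟨h1, h2⟩ := rowmotion_inv_apply (file r s k) (rowmotion r s (file r s k) x)
  rw [show (rowmotion r s (file r s k))⁻¹ (rowmotion r s (file r s k) x) = x from
    Equiv.symm_apply_apply _ x] at h1 h2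
  simp only [mem_file] at h1 h2
  refine ⟨fun h => (h1 p h).symm, fun h => ?_⟩
  have h3 := h2 p h
  have h4 : minAbove (rowmotion r s (file r s k) x) p = minAbove x p := by
    refine minAbove_congr' fun q hq => (h1 q fun h' => ?_).symm
    rcases prod_covBy_iff.1 hq with ⟨ha, hb⟩ | ⟨ha, hb⟩ <;> rw [hb] at h <;> omega
  rw [← h4]
  linarith

/-- Toggling in a sequence of distinct files. -/
theorem files_apply {κ : ℕ → ℤ} (hκ : Function.Injective κ) (n : ℕ) (x : Fin r × Fin s → ℝ) :
    (∀ p : Fin r × Fin s, (∀ t < n, (p.1.val : ℤ) - p.2.val ≠ κ t) →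
      ((List.range n).map fun t => rowmotion r s (file r s (κ t))).reverse.prod x p = x p) ∧
    ∀ t < n, ∀ p : Fin r × Fin s, (p.1.val : ℤ) - p.2.val = κ t →
      -- `w` is the labeling just before file `κ t` is toggled: earlier files carry their final
      -- labels, the others their initial ones.
      ∃ w : Fin r × Fin s → ℝ,
        (∀ q : Fin r × Fin s, (∃ t' < t, (q.1.val : ℤ) - q.2.val = κ t') → w q =
          ((List.range n).map fun t => rowmotion r s (file r s (κ t))).reverse.prod x q) ∧
        (∀ q : Fin r × Fin s, (∀ t' < t, (q.1.val : ℤ) - q.2.val ≠ κ t') → w q = x q) ∧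
        ((List.range n).map fun t => rowmotion r s (file r s (κ t))).reverse.prod x p =
          minAbove w p + maxBelow w p - x p := by
  induction n with
  | zero => simp
  | succ n ih =>
    obtain ⟨ih1, ih2⟩ := ih
    simp only [List.range_succ, List.map_append, List.reverse_append, List.map_cons,
      List.map_nil, List.reverse_singleton, List.singleton_append, List.prod_cons,
      Equiv.Perm.mul_apply]
    set z := ((List.range n).map fun t => rowmotion r s (file r s (κ t))).reverse.prod x with hz
    refine ⟨fun p hp => ?_, fun t ht p hp => ?_⟩
    · rw [(rowmotion_file_apply (κ n) z p).1 (hp n (Nat.lt_succ_self n)),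
        ih1 p fun t ht => hp t (by omega)]
    · have hkeep : ∀ t' < n, ∀ q : Fin r × Fin s, (q.1.val : ℤ) - q.2.val = κ t' →
          rowmotion r s (file r s (κ n)) z q = z q := by
        intro t' ht' q hq
        refine (rowmotion_file_apply (κ n) z q).1 fun h => ?_
        have := hκ (hq.symm.trans h)
        omega
      rcases Nat.lt_succ_iff_lt_or_eq.1 ht with ht | rfl
      · obtain ⟨w, h1, h2, h3⟩ := ih2 t ht p hp
        refine ⟨w, fun q hq => ?_, h2, ?_⟩
        · rw [h1 q hq]
          obtain ⟨t', ht', hq⟩ := hq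
          exact (hkeep t' (ht'.trans ht) q hq).symm
        · rw [hkeep t ht p hp, h3]
      · refine ⟨z, fun q ⟨t', ht', hq⟩ => (hkeep t' ht' q hq).symm, ih1, ?_⟩
        rw [(rowmotion_file_apply (κ t) z p).2 hp, ih1 p fun t' ht' h => ?_]
        have := hκ (hp.symm.trans h)
        omega

/-- The values `u` and `v` stand for the two lower neighbours, with `0` for one outside of the
rectangle. Since both are nonnegative, this agrees with the convention that an empty maximum is `0`.
-/
theorem maxBelow_prod {y : Fin r × Fin s → ℝ} {p : Fin r × Fin s} {u v : ℝ} (hu0 : 0 ≤ u)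
    (hv0 : 0 ≤ v) (hu : ∀ i : Fin r, i.val + 1 = p.1.val → y (i, p.2) = u)
    (hv : ∀ j : Fin s, j.val + 1 = p.2.val → y (p.1, j) = v) (hu' : p.1.val = 0 → u = 0)
    (hv' : p.2.val = 0 → v = 0) : maxBelow y p = max u v := by
  have hmem : ∀ q : Fin r × Fin s, q ⋖ p → y q = u ∨ y q = v := by
    rintro ⟨i, j⟩ hq
    rcases prod_covBy_iff.1 hq with ⟨ha, hb⟩ | ⟨ha, hb⟩
    · simp only at hb; subst hb; exact Or.inl (hu i ha)
    · simp only at hb; subst hb; exact Or.inr (hv j ha)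
  apply maxBelow_eq
  · intro q hq
    rcases hmem q hq with h | h <;> rw [h]
    exacts [le_max_left _ _, le_max_right _ _]
  · have hi : p.1.val ≠ 0 → ∃ q, q ⋖ p ∧ y q = u := fun h =>
      ⟨(⟨p.1.val - 1, by omega⟩, p.2), prod_covBy_iff.2 (Or.inl ⟨by simp only; omega, rfl⟩),
        hu _ (by simp only; omega)⟩
    have hj : p.2.val ≠ 0 → ∃ q, q ⋖ p ∧ y q = v := fun h =>
      ⟨(p.1, ⟨p.2.val - 1, by omega⟩), prod_covBy_iff.2 (Or.inr ⟨by simp only; omega, rfl⟩),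
        hv _ (by simp only; omega)⟩
    by_cases h1 : p.1.val = 0
    · rw [hu' h1, max_eq_right hv0]
      by_cases h2 : p.2.val = 0
      · refine Or.inr ⟨fun q hq => ?_, hv' h2⟩
        rcases prod_covBy_iff.1 hq with ⟨ha, -⟩ | ⟨ha, -⟩ <;> omega
      · exact Or.inl (hj h2)
    · by_cases h2 : p.2.val = 0
      · rw [hv' h2, max_eq_left hu0]
        exact Or.inl (hi h1)
      · rcases max_choice u v with h | h <;> rw [h]
        exacts [Or.inl (hi h1), Or.inl (hj h2)]

theorem minAbove_prod {y : Fin r × Fin s → ℝ} {p : Fin r × Fin s} {u v : ℝ}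
    (hp1 : p.1.val + 1 < r) (hp2 : p.2.val + 1 < s)
    (hu : ∀ i : Fin r, p.1.val + 1 = i.val → y (i, p.2) = u)
    (hv : ∀ j : Fin s, p.2.val + 1 = j.val → y (p.1, j) = v) : minAbove y p = min u v := by
  apply minAbove_eq
  · rintro ⟨i, j⟩ hq
    rcases prod_covBy_iff.1 hq with ⟨ha, hb⟩ | ⟨ha, hb⟩
    · simp only at hb; subst hb; rw [hu i ha]; exact min_le_left _ _
    · simp only at hb; subst hb; rw [hv j ha]; exact min_le_right _ _
  · rcases min_choice u v with h | h <;> rw [h]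
    · exact ⟨(⟨p.1.val + 1, hp1⟩, p.2), prod_covBy_iff.2 (Or.inl ⟨rfl, rfl⟩), hu _ rfl⟩
    · exact ⟨(p.1, ⟨p.2.val + 1, hp2⟩), prod_covBy_iff.2 (Or.inr ⟨rfl, rfl⟩), hv _ rfl⟩

theorem minAbove_prod_right {y : Fin r × Fin s → ℝ} {p : Fin r × Fin s} {v : ℝ}
    (hp1 : p.1.val + 1 = r) (hp2 : p.2.val + 1 < s)
    (hv : ∀ j : Fin s, p.2.val + 1 = j.val → y (p.1, j) = v) : minAbove y p = v := by
  apply minAbove_eq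
  · rintro ⟨i, j⟩ hq
    rcases prod_covBy_iff.1 hq with ⟨ha, hb⟩ | ⟨ha, hb⟩
    · have := i.2; simp only at ha; omega
    · simp only at hb; subst hb; rw [hv j ha]
  · exact ⟨(p.1, ⟨p.2.val + 1, hp2⟩), prod_covBy_iff.2 (Or.inr ⟨rfl, rfl⟩), hv _ rfl⟩

theorem minAbove_prod_left {y : Fin r × Fin s → ℝ} {p : Fin r × Fin s} {u : ℝ}
    (hp1 : p.1.val + 1 < r) (hp2 : p.2.val + 1 = s)
    (hu : ∀ i : Fin r, p.1.val + 1 = i.val → y (i, p.2) = u) : minAbove y p = u := by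
  apply minAbove_eq
  · rintro ⟨i, j⟩ hq
    rcases prod_covBy_iff.1 hq with ⟨ha, hb⟩ | ⟨ha, hb⟩
    · simp only at hb; subst hb; rw [hu i ha]
    · have := j.2; simp only at ha; omega
  · exact ⟨(⟨p.1.val + 1, hp1⟩, p.2), prod_covBy_iff.2 (Or.inl ⟨rfl, rfl⟩), hu _ rfl⟩

/-- A labeling of `[r] × [s]` as a matrix, extended by zero. -/
noncomputable def toMatrix (x : Fin r × Fin s → ℝ) (i j : ℕ) : ℝ :=
  if h : i < r ∧ j < s then x (⟨i, h.1⟩, ⟨j, h.2⟩) else 0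

theorem toMatrix_apply (x : Fin r × Fin s → ℝ) (p : Fin r × Fin s) :
    toMatrix x p.1 p.2 = x p := by
  rw [toMatrix, dif_pos ⟨p.1.2, p.2.2⟩]

theorem toMatrix_of_lt (x : Fin r × Fin s → ℝ) {i j : ℕ} (hi : i < r) (hj : j < s) :
    toMatrix x i j = x (⟨i, hi⟩, ⟨j, hj⟩) := by
  rw [toMatrix, dif_pos ⟨hi, hj⟩]

theorem toMatrix_nonneg {x : Fin r × Fin s → ℝ} (hx : ∀ p, 0 ≤ x p) (i j : ℕ) :
    0 ≤ toMatrix x i j := by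
  unfold toMatrix
  split_ifs
  exacts [hx _, le_rfl]

/-- The inverse transfer map satisfies the recursion of last passage times. -/
theorem transfer_inv_eq_shape {x : Fin r × Fin s → ℝ} (hx : ∀ p, 0 ≤ x p) (p : Fin r × Fin s) :
    transfer⁻¹ x p = shape 0 (toMatrix x) (p.1 + 1) (p.2 + 1) := by
  have hX := toMatrix_nonneg hx
  induction p using WellFoundedLT.induction with
  | ind p ih =>
    rw [transfer_inv_apply, maxBelow_prod (shape_nonneg hX 0 p.1 (p.2 + 1))
      (shape_nonneg hX 0 (p.1 + 1) p.2)]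
    · rw [← toMatrix_apply x p, add_comm]
      exact (lam_succ _ _ _).symm
    · intro i hi
      rw [ih (i, p.2) (CovBy.lt (prod_covBy_iff.2 (Or.inl ⟨hi, rfl⟩) : (i, p.2) ⋖ p)), hi]
    · intro j hj
      rw [ih (p.1, j) (CovBy.lt (prod_covBy_iff.2 (Or.inr ⟨hj, rfl⟩) : (p.1, j) ⋖ p)), hj]
    · intro h; rw [h]; exact shape_eq_zero_left hX le_rfl _
    · intro h; rw [h]; exact shape_eq_zero_right hX le_rfl _

/-- RSK computes the shapes of the initial subrectangles touching the upper boundary. -/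
theorem RSK_apply {x : Fin r × Fin s → ℝ} (hx : ∀ p, 0 ≤ x p) (p : Fin r × Fin s) (t : ℕ)
    (ht : t = min (r - 1 - p.1) (s - 1 - p.2)) :
    RSK r s x p = shape t (toMatrix x) (p.1 + 1 + t) (p.2 + 1 + t) := by
  have hX := toMatrix_nonneg hx
  -- After `n` inverse rowmotions the label at `p` has climbed `t` steps along its file, where `t`
  -- is at most `n` and is capped by the distance to the upper boundary.
  have key : ∀ n, ∀ p : Fin r × Fin s, ∀ t, t = min n (min (r - 1 - p.1) (s - 1 - p.2)) →
      ((List.range n).map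
        (fun t => (rowmotion r s (ideal r s (r - 1 - t) (s - 1 - t)))⁻¹)).reverse.prod
          (transfer⁻¹ x) p = shape t (toMatrix x) (p.1 + 1 + t) (p.2 + 1 + t) := by
    intro n
    induction n with
    | zero =>
      intro p t ht
      obtain rfl : t = 0 := by omega
      simpa using transfer_inv_eq_shape hx p
    | succ n ih =>
      simp only [List.range_succ, List.map_append, List.reverse_append, List.map_cons,
        List.map_nil, List.reverse_singleton, List.singleton_append, List.prod_cons,
        Equiv.Perm.mul_apply]
      set y := ((List.range n).map
        (fun t => (rowmotion r s (ideal r s (r - 1 - t) (s - 1 - t)))⁻¹)).reverse.prod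
          (transfer⁻¹ x) with hy
      obtain ⟨h1, h2⟩ := rowmotion_inv_apply (ideal r s (r - 1 - n) (s - 1 - n)) y
      simp only [mem_ideal] at h1 h2
      intro p
      induction p using WellFoundedLT.induction with
      | ind p ihp =>
        intro t ht
        by_cases hp : p.1.val < r - 1 - n ∧ p.2.val < s - 1 - n
        · obtain rfl : t = n + 1 := by omega
          have e1 : p.1.val + 1 + (n + 1) = p.1.val + n + 1 + 1 := by omega
          have e2 : p.2.val + 1 + (n + 1) = p.2.val + n + 1 + 1 := by omega
          have h3 := h2 p hp
          -- Inverse rowmotion toggles upwards: lower covers already carry part `n + 1`, upper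
          -- covers still carry part `n`. The toggle is then the local rule `shape_succ_succ`.
          rw [maxBelow_prod (shape_nonneg hX (n + 1) (p.1 + n + 1) (p.2 + n + 1 + 1))
              (shape_nonneg hX (n + 1) (p.1 + n + 1 + 1) (p.2 + n + 1)),
            minAbove_prod (u := shape n (toMatrix x) (p.1 + n + 1 + 1) (p.2 + n + 1))
              (v := shape n (toMatrix x) (p.1 + n + 1) (p.2 + n + 1 + 1)) (by omega) (by omega),
            ih p n (by omega)] at h3
          · refine h3.trans ?_
            rw [e1, e2, shape_succ_succ n _ (p.1 + n + 1) (p.2 + n + 1), min_comm,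
              show p.1.val + 1 + n = p.1.val + n + 1 by omega,
              show p.2.val + 1 + n = p.2.val + n + 1 by omega]
            ring
          · intro i hi
            rw [ih _ n (by simp only; omega)]
            simp only [← hi]
            congr 1 <;> omega
          · intro j hj
            rw [ih _ n (by simp only; omega)]
            simp only [← hj]
            congr 1 <;> omega
          · intro i hi
            refine (ihp (i, p.2)
              (CovBy.lt (prod_covBy_iff.2 (Or.inl ⟨hi, rfl⟩) : (i, p.2) ⋖ p)) (n + 1)
              (by simp only; omega)).trans ?_
            congr 1 <;> simp only <;> omega
          · intro j hj
            refine (ihp (p.1, j)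
              (CovBy.lt (prod_covBy_iff.2 (Or.inr ⟨hj, rfl⟩) : (p.1, j) ⋖ p)) (n + 1)
              (by simp only; omega)).trans ?_
            congr 1 <;> simp only <;> omega
          · intro h; exact shape_eq_zero_left hX (by omega) _
          · intro h; exact shape_eq_zero_right hX (by omega) _
        · rw [h1 p hp]
          exact ih p t (by omega)
  exact key _ p t (by omega)

end Rectangle

/-! ### The maps `omegaP` and `omegaQ` -/

section Omega

variable {r s : ℕ}

/-- `Z` arises from `Y` by toggling in all files strictly left of `(r, s)`. -/
def IsFilePromotion (r s : ℕ) (Y Z : ℕ → ℕ → ℝ) : Prop :=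
  (∀ i < r, ∀ j < s, i + s ≤ j + r → Z i j = Y i j) ∧
    ∀ i < r, ∀ j < s, j + r < i + s → ∀ u v, 0 ≤ u → 0 ≤ v → (i = 0 → u = 0) →
      (j = 0 → v = 0) → (i ≠ 0 → Y (i - 1) j = u) → (j ≠ 0 → Z i (j - 1) = v) →
      Z i j = (if i + 1 < r then min (Z (i + 1) j) (Y i (j + 1)) else Y i (j + 1)) + max u v -
        Y i j

/-- On the toggled side of the file of the top element, the label at `(r - 1 - k, c - k)` is the
part `k` of the shape of `[r] × [c + 1]`, so the toggles there become the promotion recurrence. The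
untouched labels give the shapes of `[i] × [s]`. -/
theorem isPromotion_of_isFilePromotion {x y Y Z : ℕ → ℕ → ℝ} (hx : ∀ i j, 0 ≤ x i j)
    (hy : ∀ i j, 0 ≤ y i j)
    (hY : ∀ i < r, ∀ j < s, ∀ t, t = min (r - 1 - i) (s - 1 - j) →
      Y i j = shape t x (i + 1 + t) (j + 1 + t))
    (hZ : ∀ i < r, ∀ j < s, ∀ t, t = min (r - 1 - i) (s - 1 - j) →
      Z i j = shape t y (i + 1 + t) (j + 1 + t))
    (h : IsFilePromotion r s Y Z) :
    IsPromotion r s x y ∧ ∀ k < s, ∀ i ≤ r, shape k x i s = shape k y i s := by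
  have hY' : ∀ k i j, i < r → j < s → k = min (r - 1 - i) (s - 1 - j) → ∀ i' j', i' = i + 1 + k →
      j' = j + 1 + k → Y i j = shape k x i' j' := by
    rintro k i j hi hj hk _ _ rfl rfl
    exact hY i hi j hj k hk
  have hZ' : ∀ k i j, i < r → j < s → k = min (r - 1 - i) (s - 1 - j) → ∀ i' j', i' = i + 1 + k →
      j' = j + 1 + k → Z i j = shape k y i' j' := by
    rintro k i j hi hj hk _ _ rfl rfl
    exact hZ i hi j hj k hk
  constructor
  · intro k hk c hc
    rcases Nat.lt_or_ge c k with hck | hck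
    -- Such a part has no position in the rectangle; both sides of the recurrence vanish.
    · rw [shape_eq_zero_right hy (j := c + 1) (by omega),
        shape_eq_zero_right hx (j := c + 1) (by omega), if_neg (by omega),
        shape_eq_zero_right hy (k := k - 1) (j := c) (by omega),
        shape_eq_zero_right hx (k := k + 1) (j := c + 2) (by omega),
        shape_eq_zero_right hy (j := c) (by omega), min_eq_left (shape_nonneg hx _ _ _)]
      simp
    · have h3 := h.2 (r - 1 - k) (by omega) (c - k) (by omega) (by omega)
        (shape (k + 1) x r (c + 2)) (shape k y r c) (shape_nonneg hx _ _ _) (shape_nonneg hy _ _ _)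
        (fun h0 => shape_eq_zero_left hx (by omega) _)
        (fun h0 => shape_eq_zero_right hy (by omega) _)
        (fun h0 => hY' _ _ _ (by omega) (by omega) (by omega) _ _ (by omega) (by omega))
        (fun h0 => hZ' _ _ _ (by omega) (by omega) (by omega) _ _ (by omega) (by omega))
      rw [hZ' k (r - 1 - k) (c - k) (by omega) (by omega) (by omega) r (c + 1) (by omega)
          (by omega),
        hY' k (r - 1 - k) (c - k) (by omega) (by omega) (by omega) r (c + 1) (by omega) (by omega),
        hY' k (r - 1 - k) (c - k + 1) (by omega) (by omega) (by omega) r (c + 2) (by omega)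
          (by omega)] at h3
      rw [h3, sub_add_cancel]
      congr 1
      by_cases hk0 : k = 0
      · subst hk0
        rw [if_neg (by omega), if_pos rfl]
      · rw [if_pos (by omega), if_neg hk0, hZ' (k - 1) (r - 1 - k + 1) (c - k) (by omega) (by omega)
          (by omega) r c (by omega) (by omega)]
  · intro k hk i hi
    rcases Nat.lt_or_ge k i with hki | hki
    · rw [← hY' k (i - 1 - k) (s - 1 - k) (by omega) (by omega) (by omega) i s (by omega)
          (by omega),
        ← hZ' k (i - 1 - k) (s - 1 - k) (by omega) (by omega) (by omega) i s (by omega) (by omega)]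
      exact (h.1 _ (by omega) _ (by omega) (by omega)).symm
    · rw [shape_eq_zero_left hx hki, shape_eq_zero_left hy hki]

/-- Files are toggled in order of decreasing `i - j`. So `(i + 1, j)` and `(i, j - 1)` are already
updated when `(i, j)` is toggled, while `(i, j + 1)` and `(i - 1, j)` are not. -/
theorem isFilePromotion_proP (y : Fin r × Fin s → ℝ) :
    IsFilePromotion r s (toMatrix y) (toMatrix (proP r s y)) := by
  have hκ : Function.Injective fun t : ℕ => (r : ℤ) - 1 - t := fun a b h => by
    simp only at h; omega
  obtain ⟨h1, h2⟩ := files_apply hκ (s - 1) y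
  constructor
  · intro i hi j hj hij
    rw [toMatrix_of_lt _ hi hj, toMatrix_of_lt _ hi hj]
    exact h1 _ fun t ht => by simp only; omega
  · intro i hi j hj hij u v hu0 hv0 hu hv hYu hZv
    have hj1 : j + 1 < s := by omega
    have hj1' : j - 1 < s := by omega
    have hi1' : i - 1 < r := by omega
    -- The index `t` solves `r - 1 - t = i - j`.
    obtain ⟨w, hw1, hw2, hw⟩ := h2 (j + r - 1 - i) (by omega) (⟨i, hi⟩, ⟨j, hj⟩)
      (by simp only; omega)
    rw [toMatrix_of_lt _ hi hj, toMatrix_of_lt _ hi hj,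
      toMatrix_of_lt _ hi hj1]
    refine hw.trans ?_
    rw [maxBelow_prod hu0 hv0 ?_ ?_ hu hv]
    · congr 2
      split_ifs with hir
      · rw [toMatrix_of_lt _ hir hj]
        refine minAbove_prod hir (by simp only; omega) (fun i' hi' => ?_) (fun j' hj' => ?_)
        · obtain rfl : i' = ⟨i + 1, hir⟩ := Fin.ext hi'.symm
          exact hw1 _ ⟨j + r - 1 - i - 1, by omega, by simp only; omega⟩
        · obtain rfl : j' = ⟨j + 1, hj1⟩ := Fin.ext hj'.symm
          exact hw2 _ fun t' ht' => by simp only; omega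
      · refine minAbove_prod_right (by simp only; omega) (by simp only; omega) (fun j' hj' => ?_)
        obtain rfl : j' = ⟨j + 1, hj1⟩ := Fin.ext hj'.symm
        exact hw2 _ fun t' ht' => by simp only; omega
    · intro i' hi'
      simp only at hi'
      obtain rfl : i' = ⟨i - 1, hi1'⟩ := Fin.ext (by simp only; omega)
      rw [← hYu (by omega), toMatrix_of_lt _ (by omega) hj]
      exact hw2 _ fun t' ht' => by simp only; omega
    · intro j' hj'
      simp only at hj'
      obtain rfl : j' = ⟨j - 1, hj1'⟩ := Fin.ext (by simp only; omega)
      rw [← hZv (by omega), toMatrix_of_lt _ hi (by omega)]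
      exact hw1 _ ⟨j + r - 1 - i - 1, by omega, by simp only; omega⟩

theorem isFilePromotion_proQ (y : Fin r × Fin s → ℝ) :
    IsFilePromotion s r (fun j i => toMatrix y i j) (fun j i => toMatrix (proQ r s y) i j) := by
  have hκ : Function.Injective fun t : ℕ => 1 - (s : ℤ) + t := fun a b h => by
    simp only at h; omega
  obtain ⟨h1, h2⟩ := files_apply hκ (r - 1) y
  constructor
  · intro j hj i hi hij
    beta_reduce
    rw [toMatrix_of_lt _ hi hj, toMatrix_of_lt _ hi hj]
    exact h1 _ fun t ht => by simp only; omega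
  · intro j hj i hi hij u v hu0 hv0 hu hv hYu hZv
    beta_reduce at hYu hZv ⊢
    have hi1 : i + 1 < r := by omega
    have hj1' : j - 1 < s := by omega
    have hi1' : i - 1 < r := by omega
    obtain ⟨w, hw1, hw2, hw⟩ := h2 (i + s - 1 - j) (by omega) (⟨i, hi⟩, ⟨j, hj⟩)
      (by simp only; omega)
    rw [toMatrix_of_lt _ hi hj, toMatrix_of_lt _ hi hj,
      toMatrix_of_lt _ hi1 hj]
    refine hw.trans ?_
    rw [max_comm u v, maxBelow_prod hv0 hu0 ?_ ?_ hv hu]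
    · congr 2
      split_ifs with hjs
      · rw [toMatrix_of_lt _ hi hjs, min_comm]
        refine minAbove_prod (by simp only; omega) hjs (fun i' hi' => ?_) (fun j' hj' => ?_)
        · obtain rfl : i' = ⟨i + 1, hi1⟩ := Fin.ext hi'.symm
          exact hw2 _ fun t' ht' => by simp only; omega
        · obtain rfl : j' = ⟨j + 1, hjs⟩ := Fin.ext hj'.symm
          exact hw1 _ ⟨i + s - 1 - j - 1, by omega, by simp only; omega⟩
      · refine minAbove_prod_left (by simp only; omega) (by simp only; omega) (fun i' hi' => ?_)
        obtain rfl : i' = ⟨i + 1, hi1⟩ := Fin.ext hi'.symm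
        exact hw2 _ fun t' ht' => by simp only; omega
    · intro i' hi'
      simp only at hi'
      obtain rfl : i' = ⟨i - 1, hi1'⟩ := Fin.ext (by simp only; omega)
      rw [← hZv (by omega), toMatrix_of_lt _ (by omega) hj]
      exact hw1 _ ⟨i + s - 1 - j - 1, by omega, by simp only; omega⟩
    · intro j' hj'
      simp only at hj'
      obtain rfl : j' = ⟨j - 1, hj1'⟩ := Fin.ext (by simp only; omega)
      rw [← hYu (by omega), toMatrix_of_lt _ hi (by omega)]
      exact hw2 _ fun t' ht' => by simp only; omega

/-- The only maximal element lies in the file `r - s`, which is not toggled. -/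
theorem proP_mem_conePreserving : proP r s ∈ conePreserving (Fin r × Fin s) := by
  refine Subgroup.list_prod_mem _ fun e he => ?_
  obtain ⟨t, ht, rfl⟩ := List.mem_map.1 (List.mem_reverse.1 he)
  refine rowmotion_mem_conePreserving fun p hp => ?_
  have hp := mem_file.1 hp
  have ht := List.mem_range.1 ht
  have := p.1.2
  exact ⟨(p.1, ⟨p.2.val + 1, by omega⟩), prod_covBy_iff.2 (Or.inr ⟨rfl, rfl⟩)⟩

theorem proQ_mem_conePreserving : proQ r s ∈ conePreserving (Fin r × Fin s) := by
  refine Subgroup.list_prod_mem _ fun e he => ?_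
  obtain ⟨t, ht, rfl⟩ := List.mem_map.1 (List.mem_reverse.1 he)
  refine rowmotion_mem_conePreserving fun p hp => ?_
  have hp := mem_file.1 hp
  have ht := List.mem_range.1 ht
  have := p.2.2
  exact ⟨(⟨p.1.val + 1, by omega⟩, p.2), prod_covBy_iff.2 (Or.inl ⟨rfl, rfl⟩)⟩

/-- The ideals in `RSK` avoid the maximal element, so membership in the cone is kept from the
inverse transfer map onwards. -/
theorem RSK_nonneg_iff (x : Fin r × Fin s → ℝ) :
    (∀ p, 0 ≤ x p) ↔ ∀ p, maxBelow (RSK r s x) p ≤ RSK r s x p := by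
  have h := transfer_nonneg_iff (transfer⁻¹ x)
  rw [show transfer (transfer⁻¹ x) = x from Equiv.apply_symm_apply _ x] at h
  rw [h]
  refine (Subgroup.list_prod_mem (conePreserving (Fin r × Fin s)) fun e he => ?_ :
    ((List.range (min r s - 1)).map (fun t => (rowmotion r s (ideal r s (r - 1 - t)
      (s - 1 - t)))⁻¹)).reverse.prod ∈ conePreserving (Fin r × Fin s)) (transfer⁻¹ x)
  obtain ⟨t, ht, rfl⟩ := List.mem_map.1 (List.mem_reverse.1 he)
  refine Subgroup.inv_mem _ (rowmotion_mem_conePreserving fun p hp => ?_)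
  have hp := mem_ideal.1 hp
  exact ⟨(⟨p.1.val + 1, by omega⟩, p.2), prod_covBy_iff.2 (Or.inl ⟨rfl, rfl⟩)⟩

theorem RSK_inv_conj_nonneg_iff {e : Equiv.Perm (Fin r × Fin s → ℝ)}
    (he : e ∈ conePreserving (Fin r × Fin s)) (x : Fin r × Fin s → ℝ) :
    (∀ p, 0 ≤ x p) ↔ ∀ p, 0 ≤ ((RSK r s)⁻¹ * e * RSK r s) x p := by
  rw [RSK_nonneg_iff, RSK_nonneg_iff, he]
  rw [show RSK r s (((RSK r s)⁻¹ * e * RSK r s) x) = e (RSK r s x) from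
    Equiv.apply_symm_apply _ _]

theorem omegaP_nonneg_iff (x : Fin r × Fin s → ℝ) :
    (∀ p, 0 ≤ x p) ↔ ∀ p, 0 ≤ omegaP r s x p :=
  RSK_inv_conj_nonneg_iff proP_mem_conePreserving x

theorem omegaQ_nonneg_iff (x : Fin r × Fin s → ℝ) :
    (∀ p, 0 ≤ x p) ↔ ∀ p, 0 ≤ omegaQ r s x p :=
  RSK_inv_conj_nonneg_iff proQ_mem_conePreserving x

theorem toMatrix_RSK {x : Fin r × Fin s → ℝ} (hx : ∀ p, 0 ≤ x p) :
    ∀ i < r, ∀ j < s, ∀ t, t = min (r - 1 - i) (s - 1 - j) →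
      toMatrix (RSK r s x) i j = shape t (toMatrix x) (i + 1 + t) (j + 1 + t) := by
  intro i hi j hj t ht
  rw [toMatrix_of_lt _ hi hj]
  exact RSK_apply hx (⟨i, hi⟩, ⟨j, hj⟩) t ht

theorem shiftsChains_omegaP {x : Fin r × Fin s → ℝ} (hx : ∀ p, 0 ≤ x p) {f g : ℤ × ℤ → ℝ}
    {a c : ℤ} (hf : ∀ p : Fin r × Fin s, f (a + (p.1.val : ℤ), c + (p.2.val : ℤ)) = x p)
    (hg : ∀ p : Fin r × Fin s, g (a + (p.1.val : ℤ), c + (p.2.val : ℤ)) = omegaP r s x p) :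
    ShiftsChains f g a c r s := by
  have hy := (omegaP_nonneg_iff x).1 hx
  have hRSK : RSK r s (omegaP r s x) = proP r s (RSK r s x) := Equiv.apply_symm_apply _ _
  have h := isFilePromotion_proP (RSK r s x)
  rw [← hRSK] at h
  obtain ⟨h1, h2⟩ := isPromotion_of_isFilePromotion (toMatrix_nonneg hx) (toMatrix_nonneg hy)
    (toMatrix_RSK hx) (toMatrix_RSK hy) h
  refine shiftsChains_of_isPromotion (toMatrix_nonneg hx) (toMatrix_nonneg hy) h1 h2
    (fun i hi j hj => ?_) (fun i hi j hj => ?_)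
  · rw [toMatrix_of_lt _ hi hj, ← hf]
  · rw [toMatrix_of_lt _ hi hj, ← hg]

/-- Reading the matrix transposed turns `proQ` into a file promotion, and the symmetry of the shapes
does the rest. -/
theorem shiftsChains_omegaQ {x : Fin r × Fin s → ℝ} (hx : ∀ p, 0 ≤ x p) {f g : ℤ × ℤ → ℝ}
    {a c : ℤ} (hf : ∀ p : Fin r × Fin s, f (a + (p.1.val : ℤ), c + (p.2.val : ℤ)) = x p)
    (hg : ∀ p : Fin r × Fin s, g (a + (p.1.val : ℤ), c + (p.2.val : ℤ)) = omegaQ r s x p) :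
    ShiftsChains (fun p => f p.swap) (fun p => g p.swap) c a s r := by
  have hy := (omegaQ_nonneg_iff x).1 hx
  have hRSK : RSK r s (omegaQ r s x) = proQ r s (RSK r s x) := Equiv.apply_symm_apply _ _
  have h := isFilePromotion_proQ (RSK r s x)
  rw [← hRSK] at h
  have hT : ∀ {x : Fin r × Fin s → ℝ}, (∀ p, 0 ≤ x p) → ∀ j < s, ∀ i < r, ∀ t,
      t = min (s - 1 - j) (r - 1 - i) → toMatrix (RSK r s x) i j =
        shape t (fun j i => toMatrix x i j) (j + 1 + t) (i + 1 + t) := by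
    intro x hx j hj i hi t ht
    exact (toMatrix_RSK hx i hi j hj t (by omega)).trans (shape_transpose t (toMatrix x) _ _).symm
  have hX : ∀ j i, 0 ≤ (fun j i => toMatrix x i j) j i := fun j i => toMatrix_nonneg hx i j
  have hY : ∀ j i, 0 ≤ (fun j i => toMatrix (omegaQ r s x) i j) j i :=
    fun j i => toMatrix_nonneg hy i j
  obtain ⟨h1, h2⟩ := isPromotion_of_isFilePromotion hX hY (hT hx) (hT hy) h
  refine shiftsChains_of_isPromotion hX hY h1 h2 (fun j hj i hi => ?_) (fun j hj i hi => ?_)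
  · rw [toMatrix_of_lt _ hi hj, ← hf]; rfl
  · rw [toMatrix_of_lt _ hi hj, ← hg]; rfl

end Omega

/-! ### Chains in polyominoes -/

/-- `A` is an antichain in a rectangle contained in `M` on which `f` does not vanish. -/
def IsChainIn (M : Finset (ℤ × ℤ)) (f : ℤ × ℤ → ℝ) (A : Finset (ℤ × ℤ)) : Prop :=
  (∃ i₁ i₂ j₁ j₂ : ℤ, (∀ i j, i₁ ≤ i → i < i₂ → j₁ ≤ j → j < j₂ → (i, j) ∈ M) ∧
      ∀ p ∈ A, i₁ ≤ p.1 ∧ p.1 < i₂ ∧ j₁ ≤ p.2 ∧ p.2 < j₂) ∧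
    IsAntichain (· ≤ ·) (A : Set (ℤ × ℤ)) ∧ ∀ p ∈ A, f p ≠ 0

theorem mem_rect {a c : ℤ} {r s : ℕ} {p : ℤ × ℤ} :
    p ∈ rect a c r s ↔ a ≤ p.1 ∧ p.1 < a + r ∧ c ≤ p.2 ∧ p.2 < c + s := by
  simp [rect, and_assoc]

theorem isStrictSoutheastChain_iff {M : Finset (ℤ × ℤ)} {x : Labeling M} {A : Finset (ℤ × ℤ)} :
    IsStrictSoutheastChain x A ↔ IsChainIn M (label x) A := by
  constructor
  · rintro ⟨⟨a, c, r, s, h1, h2⟩, h3, h4⟩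
    refine ⟨⟨a, a + r, c, c + s, fun i j hi hi' hj hj' => h1 (mem_rect.2 ⟨hi, hi', hj, hj'⟩),
      fun p hp => mem_rect.1 (h2 hp)⟩, h3, h4⟩
  · rintro ⟨⟨i₁, i₂, j₁, j₂, h1, h2⟩, h3, h4⟩
    refine ⟨⟨i₁, j₁, (i₂ - i₁).toNat, (j₂ - j₁).toNat, fun p hp => ?_, fun p hp => ?_⟩, h3, h4⟩
    · obtain ⟨ha, hb, hc, hd⟩ := mem_rect.1 hp
      exact h1 p.1 p.2 ha (by omega) hc (by omega)
    · obtain ⟨ha, hb, hc, hd⟩ := h2 p hp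
      exact mem_rect.2 ⟨ha, by omega, hc, by omega⟩

/-- `f` on `M` and `g` on `N` have chains of the same sizes. -/
def SameChains (M N : Finset (ℤ × ℤ)) (f g : ℤ × ℤ → ℝ) : Prop :=
  ∀ k, (∃ A, IsChainIn M f A ∧ A.card = k) ↔ ∃ A, IsChainIn N g A ∧ A.card = k

theorem longestSE_le {M N : Finset (ℤ × ℤ)} {x : Labeling M} {y : Labeling N}
    (h : ∀ A, IsChainIn M (label x) A → ∃ B, IsChainIn N (label y) B ∧ B.card = A.card) :
    longestSE x ≤ longestSE y := by
  classical
  refine Finset.sup_le fun A hA => ?_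
  obtain ⟨B, hB, hBA⟩ := h A (isStrictSoutheastChain_iff.1 (Finset.mem_filter.1 hA).2)
  rw [← hBA]
  refine Finset.le_sup (f := Finset.card) (Finset.mem_filter.2 ⟨Finset.mem_powerset.2 ?_,
    isStrictSoutheastChain_iff.2 hB⟩)
  obtain ⟨⟨i₁, i₂, j₁, j₂, h1, h2⟩, -⟩ := hB
  intro p hp
  obtain ⟨ha, hb, hc, hd⟩ := h2 p hp
  exact h1 p.1 p.2 ha hb hc hd

theorem SameChains.longestSE_eq {M N : Finset (ℤ × ℤ)} {x : Labeling M} {y : Labeling N}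
    (h : SameChains M N (label x) (label y)) : longestSE x = longestSE y :=
  le_antisymm (longestSE_le fun A hA => (h A.card).1 ⟨A, hA, rfl⟩)
    (longestSE_le fun A hA => (h A.card).2 ⟨A, hA, rfl⟩)

/-- The reflection of a polyomino that exchanges the coordinates. -/
def transpose (M : Finset (ℤ × ℤ)) : Finset (ℤ × ℤ) := M.map (Equiv.prodComm ℤ ℤ).toEmbedding

theorem mem_transpose {M : Finset (ℤ × ℤ)} {i j : ℤ} : (i, j) ∈ transpose M ↔ (j, i) ∈ M := by
  simp [transpose]

theorem transpose_transpose (M : Finset (ℤ × ℤ)) : transpose (transpose M) = M := by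
  ext ⟨i, j⟩
  rw [mem_transpose, mem_transpose]

theorem IsChainIn.transpose {M : Finset (ℤ × ℤ)} {f : ℤ × ℤ → ℝ} {A : Finset (ℤ × ℤ)}
    (h : IsChainIn M f A) :
    IsChainIn (transpose M) (fun p => f p.swap) (A.map (Equiv.prodComm ℤ ℤ).toEmbedding) := by
  obtain ⟨⟨i₁, i₂, j₁, j₂, h1, h2⟩, h3, h4⟩ := h
  refine ⟨⟨j₁, j₂, i₁, i₂, fun i j hi hi' hj hj' => mem_transpose.2 (h1 j i hj hj' hi hi'), ?_⟩,
    isAntichain_swap h3, ?_⟩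
  · intro p hp
    obtain ⟨q, hq, rfl⟩ := Finset.mem_map.1 hp
    obtain ⟨ha, hb, hc, hd⟩ := h2 q hq
    exact ⟨hc, hd, ha, hb⟩
  · intro p hp
    obtain ⟨q, hq, rfl⟩ := Finset.mem_map.1 hp
    exact h4 q hq

theorem exists_isChainIn_transpose {M : Finset (ℤ × ℤ)} {f : ℤ × ℤ → ℝ} {k : ℕ} :
    (∃ A, IsChainIn (transpose M) (fun p => f p.swap) A ∧ A.card = k) ↔
      ∃ A, IsChainIn M f A ∧ A.card = k := by
  constructor
  · rintro ⟨A, hA, rfl⟩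
    have := hA.transpose
    rw [transpose_transpose] at this
    exact ⟨_, this, by simp⟩
  · rintro ⟨A, hA, rfl⟩
    exact ⟨_, hA.transpose, by simp⟩

theorem sameChains_transpose {M N : Finset (ℤ × ℤ)} {f g : ℤ × ℤ → ℝ} :
    SameChains (transpose M) (transpose N) (fun p => f p.swap) (fun p => g p.swap) ↔
      SameChains M N f g :=
  forall_congr' fun _ => by rw [exists_isChainIn_transpose, exists_isChainIn_transpose]

theorem isAntichain_union {A B : Finset (ℤ × ℤ)}
    (hA : IsAntichain (· ≤ ·) (A : Set (ℤ × ℤ))) (hB : IsAntichain (· ≤ ·) (B : Set (ℤ × ℤ)))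
    (h : ∀ p ∈ A, ∀ q ∈ B, (p.1 < q.1 ∧ q.2 < p.2) ∨ (q.1 < p.1 ∧ p.2 < q.2)) :
    IsAntichain (· ≤ ·) ((A ∪ B : Finset (ℤ × ℤ)) : Set (ℤ × ℤ)) ∧
      (A ∪ B).card = A.card + B.card := by
  constructor
  · intro p hp q hq hpq hle
    have h1 := hle.1
    have h2 := hle.2
    rcases Finset.mem_union.1 hp with hp | hp <;> rcases Finset.mem_union.1 hq with hq | hq
    · exact hA hp hq hpq hle
    · have := h p hp q hq; omega
    · have := h q hq p hp; omega
    · exact hB hp hq hpq hle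
  · refine Finset.card_union_of_disjoint (Finset.disjoint_left.2 fun p hp hq => ?_)
    have := h p hp p hq
    omega

/-! ### Shifting the rows outside of a rectangle -/

/-- `N` arises from `M` by shifting by `δ` all up-diagonals that do not meet the given
rectangle. -/
structure IsRowShift (M N : Finset (ℤ × ℤ)) (a c : ℤ) (r s : ℕ) (δ : ℤ) : Prop where
  inside : ∀ i j, a ≤ i → i < a + r → ((i, j) ∈ M ↔ (i, j) ∈ N)
  outside : ∀ i j, ¬ (a ≤ i ∧ i < a + r) → ((i, j) ∈ M ↔ (i, j + δ) ∈ N)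
  columns : ∀ i j, ¬ (a ≤ i ∧ i < a + r) → (i, j) ∈ M →
    c ≤ j ∧ j < c + s ∧ c ≤ j + δ ∧ j + δ < c + s
  rect : ∀ i j, a ≤ i → i < a + r → c ≤ j → j < c + s → (i, j) ∈ M

theorem IsRowShift.symm {M N : Finset (ℤ × ℤ)} {a c : ℤ} {r s : ℕ} {δ : ℤ}
    (h : IsRowShift M N a c r s δ) : IsRowShift N M a c r s (-δ) where
  inside i j hi hi' := (h.inside i j hi hi').symm
  outside i j hi := by rw [h.outside i (j + -δ) hi, neg_add_cancel_right]
  columns i j hi hij := by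
    have := h.columns i (j + -δ) hi (by rwa [h.outside i _ hi, neg_add_cancel_right])
    omega
  rect i j hi hi' hj hj' := (h.inside i j hi hi').1 (h.rect i j hi hi' hj hj')

/-- The row interval is chosen as tight as possible. The new chain then lies between the extreme
rows of the old one, which keeps it incomparable to the boxes of the chain outside of the rectangle.
-/
theorem exists_chain_rows {f g : ℤ × ℤ → ℝ} {a c : ℤ} {r s : ℕ}
    (h : ∀ i₁ i₂ k, a ≤ i₁ → i₁ ≤ a + r → a ≤ i₂ → i₂ ≤ a + r →
      HasSE f i₁ i₂ c (c + s) k → HasSE g i₁ i₂ c (c + s) k)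
    {A : Finset (ℤ × ℤ)} (hA : IsAntichain (· ≤ ·) (A : Set (ℤ × ℤ)))
    (hA' : ∀ p ∈ A, (a ≤ p.1 ∧ p.1 < a + r ∧ c ≤ p.2 ∧ p.2 < c + s) ∧ f p ≠ 0) :
    ∃ B : Finset (ℤ × ℤ), B.card = A.card ∧ IsAntichain (· ≤ ·) (B : Set (ℤ × ℤ)) ∧
      ∀ q ∈ B, (c ≤ q.2 ∧ q.2 < c + s) ∧ g q ≠ 0 ∧ (∃ p ∈ A, p.1 ≤ q.1) ∧ ∃ p ∈ A, q.1 ≤ p.1 := by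
  rcases A.eq_empty_or_nonempty with rfl | hne
  · exact ⟨∅, rfl, by simp, by simp⟩
  · obtain ⟨p₁, hp₁, hmin⟩ := A.exists_min_image Prod.fst hne
    obtain ⟨p₂, hp₂, hmax⟩ := A.exists_max_image Prod.fst hne
    obtain ⟨⟨h1, h2, -, -⟩, -⟩ := hA' p₁ hp₁
    obtain ⟨⟨h1', h2', -, -⟩, -⟩ := hA' p₂ hp₂
    obtain ⟨B, hBc, hB, hB'⟩ := h p₁.1 (p₂.1 + 1) A.card h1 h2.le (by omega) (by omega)
      ⟨A, rfl, hA, fun p hp => ⟨hmin p hp, Int.lt_add_one_of_le (hmax p hp),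
        (hA' p hp).1.2.2.1, (hA' p hp).1.2.2.2, (hA' p hp).2⟩⟩
    refine ⟨B, hBc, hB, fun q hq => ?_⟩
    obtain ⟨e1, e2, e3, e4, e5⟩ := hB' q hq
    exact ⟨⟨e3, e4⟩, e5, ⟨p₁, hp₁, e1⟩, ⟨p₂, hp₂, by omega⟩⟩

theorem exists_chain_columns {f g : ℤ × ℤ → ℝ} {a c : ℤ} {r s : ℕ} {δ : ℤ}
    (h : ∀ j₁ j₂ k, c ≤ j₁ → c ≤ j₁ + δ → j₁ < j₂ → j₂ ≤ c + s → j₂ + δ ≤ c + s →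
      HasSE f a (a + r) j₁ j₂ k → HasSE g a (a + r) (j₁ + δ) (j₂ + δ) k)
    {A : Finset (ℤ × ℤ)} (hA : IsAntichain (· ≤ ·) (A : Set (ℤ × ℤ)))
    (hA' : ∀ p ∈ A, (a ≤ p.1 ∧ p.1 < a + r ∧ c ≤ p.2 ∧ p.2 < c + s) ∧
      c ≤ p.2 + δ ∧ p.2 + δ < c + s ∧ f p ≠ 0) :
    ∃ B : Finset (ℤ × ℤ), B.card = A.card ∧ IsAntichain (· ≤ ·) (B : Set (ℤ × ℤ)) ∧
      ∀ q ∈ B, (a ≤ q.1 ∧ q.1 < a + r) ∧ g q ≠ 0 ∧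
        (∃ p ∈ A, p.2 + δ ≤ q.2) ∧ ∃ p ∈ A, q.2 ≤ p.2 + δ := by
  rcases A.eq_empty_or_nonempty with rfl | hne
  · exact ⟨∅, rfl, by simp, by simp⟩
  · obtain ⟨p₁, hp₁, hmin⟩ := A.exists_min_image Prod.snd hne
    obtain ⟨p₂, hp₂, hmax⟩ := A.exists_max_image Prod.snd hne
    obtain ⟨⟨-, -, h1, h2⟩, h3, h4, -⟩ := hA' p₁ hp₁
    obtain ⟨⟨-, -, h1', h2'⟩, h3', h4', -⟩ := hA' p₂ hp₂
    have := hmin p₂ hp₂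
    obtain ⟨B, hBc, hB, hB'⟩ := h p₁.2 (p₂.2 + 1) A.card h1 h3 (by omega) (by omega) (by omega)
      ⟨A, rfl, hA, fun p hp => ⟨(hA' p hp).1.1, (hA' p hp).1.2.1, hmin p hp,
        Int.lt_add_one_of_le (hmax p hp), (hA' p hp).2.2.2⟩⟩
    refine ⟨B, hBc, hB, fun q hq => ?_⟩
    obtain ⟨e1, e2, e3, e4, e5⟩ := hB' q hq
    exact ⟨⟨e1, e2⟩, e5, ⟨p₁, hp₁, e3⟩, ⟨p₂, hp₂, by omega⟩⟩

/-- Only the part of the chain in the rectangle is exchanged. Which interval property applies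
depends on whether the chain leaves the rows of the rectangle. Allowing a general `δ` covers the
shift and its inverse at once. -/
theorem IsRowShift.exists_isChainIn {M N : Finset (ℤ × ℤ)} {a c : ℤ} {r s : ℕ} {δ : ℤ}
    (h : IsRowShift M N a c r s δ) (hN : IsMoon N) (hr : 0 < r) (hs : 0 < s) {f g : ℤ × ℤ → ℝ}
    (hin : ∀ i j, a ≤ i → i < a + r → ¬ (c ≤ j ∧ j < c + s) → f (i, j) = g (i, j))
    (hout : ∀ i j, ¬ (a ≤ i ∧ i < a + r) → f (i, j) = g (i, j + δ))
    (hrows : ∀ i₁ i₂ k, a ≤ i₁ → i₁ ≤ a + r → a ≤ i₂ → i₂ ≤ a + r →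
      HasSE f i₁ i₂ c (c + s) k → HasSE g i₁ i₂ c (c + s) k)
    (hcolumns : ∀ j₁ j₂ k, c ≤ j₁ → c ≤ j₁ + δ → j₁ < j₂ → j₂ ≤ c + s → j₂ + δ ≤ c + s →
      HasSE f a (a + r) j₁ j₂ k → HasSE g a (a + r) (j₁ + δ) (j₂ + δ) k)
    {A : Finset (ℤ × ℤ)} (hA : IsChainIn M f A) :
    ∃ B, IsChainIn N g B ∧ B.card = A.card := by
  classical
  obtain ⟨⟨i₁, i₂, j₁, j₂, hM, hAr⟩, hA, hf⟩ := hA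
  rcases A.eq_empty_or_nonempty with rfl | ⟨p₀, hp₀⟩
  · exact ⟨∅, ⟨⟨0, 0, 0, 0, fun i j _ _ _ _ => by omega, by simp⟩, by simp, by simp⟩, rfl⟩
  have hp₀r := hAr p₀ hp₀
  have hinc : ∀ p ∈ A, ∀ q ∈ A, p ≠ q →
      (p.1 < q.1 ∧ q.2 < p.2) ∨ (q.1 < p.1 ∧ p.2 < q.2) := by
    intro p hp q hq hpq
    have h1 : ¬ (p.1 ≤ q.1 ∧ p.2 ≤ q.2) := fun hle => hA hp hq hpq hle
    have h2 : ¬ (q.1 ≤ p.1 ∧ q.2 ≤ p.2) := fun hle => hA hq hp hpq.symm hle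
    omega
  have hrectN := h.symm.rect
  set R := A.filter fun p => a ≤ p.1 ∧ p.1 < a + r ∧ c ≤ p.2 ∧ p.2 < c + s with hR
  set O := A.filter fun p => ¬ (a ≤ p.1 ∧ p.1 < a + r ∧ c ≤ p.2 ∧ p.2 < c + s) with hO
  have hcard : R.card + O.card = A.card := Finset.card_filter_add_card_filter_not _
  have hRA : IsAntichain (· ≤ ·) (R : Set (ℤ × ℤ)) := hA.subset (Finset.filter_subset _ _)
  have hOA : IsAntichain (· ≤ ·) (O : Set (ℤ × ℤ)) := hA.subset (Finset.filter_subset _ _)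
  by_cases hall : ∀ p ∈ A, a ≤ p.1 ∧ p.1 < a + r
  -- The remaining boxes lie to the left or to the right of the columns of the rectangle, hence
  -- strictly below or above all rows used by the exchanged part.
  · obtain ⟨B, hBc, hB, hB'⟩ := exists_chain_rows hrows hRA fun p hp =>
      ⟨(Finset.mem_filter.1 hp).2, hf p (Finset.mem_filter.1 hp).1⟩
    obtain ⟨h1, h2⟩ := isAntichain_union hOA hB fun p hp q hq => by
      obtain ⟨hpA, hpn⟩ := Finset.mem_filter.1 hp
      obtain ⟨hq1, -, ⟨u, hu, hu'⟩, ⟨v, hv, hv'⟩⟩ := hB' q hq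
      obtain ⟨huA, hur⟩ := Finset.mem_filter.1 hu
      obtain ⟨hvA, hvr⟩ := Finset.mem_filter.1 hv
      have e1 := hinc p hpA u huA (by rintro rfl; exact hpn hur)
      have e2 := hinc p hpA v hvA (by rintro rfl; exact hpn hvr)
      have e3 := hall p hpA
      omega
    refine ⟨O ∪ B, ⟨⟨max i₁ a, min i₂ (a + r), min j₁ c, max j₂ (c + s), ?_, ?_⟩, h1, ?_⟩,
      by omega⟩
    -- Each of these rows of `N` contains both column intervals, hence by convexity also the
    -- interval spanned by them.
    · intro i j hi hi' hj hj'
      have hconn := hN.up_convex i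
      have m1 : ∀ j, c ≤ j → j < c + s → j ∈ upDiagonal N i := fun j hj hj' =>
        hrectN i j (by omega) (by omega) hj hj'
      have m2 : ∀ j, j₁ ≤ j → j < j₂ → j ∈ upDiagonal N i := fun j hj hj' =>
        (h.inside i j (by omega) (by omega)).1 (hM i j (by omega) (by omega) hj hj')
      rcases lt_or_ge j c with h3 | h3
      · exact hconn.out (m2 j₁ le_rfl (by omega)) (m1 c le_rfl (by omega)) ⟨by omega, by omega⟩
      · rcases lt_or_ge j (c + s) with h4 | h4
        · exact m1 j h3 h4
        · exact hconn.out (m1 c le_rfl (by omega)) (m2 (j₂ - 1) (by omega) (by omega))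
            ⟨by omega, by omega⟩
    · intro p hp
      rcases Finset.mem_union.1 hp with hp | hp
      · have hpA := (Finset.mem_filter.1 hp).1
        have e1 := hAr p hpA
        have e2 := hall p hpA
        omega
      · obtain ⟨hq1, -, ⟨u, hu, hu'⟩, ⟨v, hv, hv'⟩⟩ := hB' p hp
        obtain ⟨huA, hur⟩ := Finset.mem_filter.1 hu
        obtain ⟨hvA, hvr⟩ := Finset.mem_filter.1 hv
        have e1 := hAr u huA
        have e2 := hAr v hvA
        omega
    · intro p hp
      rcases Finset.mem_union.1 hp with hp | hp
      · obtain ⟨hpA, hpn⟩ := Finset.mem_filter.1 hp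
        obtain ⟨e1, e2⟩ := hall p hpA
        rw [← hin p.1 p.2 e1 e2 (by omega)]
        exact hf p hpA
      · exact (hB' p hp).2.1
  · push Not at hall
    obtain ⟨p₁, hp₁, hp₁r⟩ := hall
    have hp₁r' : ¬ (a ≤ p₁.1 ∧ p₁.1 < a + r) := fun h => by have := hp₁r h.1; omega
    -- The enclosing rectangle of the chain meets a row outside of those of `R`, and such a row has
    -- no box beyond the columns of `R`, before or after the shift.
    have hcol : ∀ j, j₁ ≤ j → j < j₂ → c ≤ j ∧ j < c + s ∧ c ≤ j + δ ∧ j + δ < c + s := by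
      intro j hj hj'
      have := hAr p₁ hp₁
      exact h.columns p₁.1 j hp₁r' (hM _ _ (by omega) (by omega) hj hj')
    have hcolA : ∀ p ∈ A, c ≤ p.2 ∧ p.2 < c + s ∧ c ≤ p.2 + δ ∧ p.2 + δ < c + s := by
      intro p hp
      have := hAr p hp
      exact hcol p.2 (by omega) (by omega)
    obtain ⟨B, hBc, hB, hB'⟩ := exists_chain_columns hcolumns hRA fun p hp => by
      obtain ⟨hpA, hpr⟩ := Finset.mem_filter.1 hp
      exact ⟨hpr, (hcolA p hpA).2.2.1, (hcolA p hpA).2.2.2, hf p hpA⟩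
    let t : ℤ × ℤ ↪ ℤ × ℤ := ⟨fun p => (p.1, p.2 + δ), fun p q hpq => by
      simp only [Prod.mk.injEq, add_left_inj] at hpq
      exact Prod.ext hpq.1 hpq.2⟩
    have hOt : IsAntichain (· ≤ ·) ((O.map t : Finset (ℤ × ℤ)) : Set (ℤ × ℤ)) := by
      intro p hp q hq hpq hle
      obtain ⟨p', hp', rfl⟩ := Finset.mem_map.1 hp
      obtain ⟨q', hq', rfl⟩ := Finset.mem_map.1 hq
      have hle2 : p'.2 + δ ≤ q'.2 + δ := hle.2
      exact hOA hp' hq' (fun h => hpq (by rw [h])) ⟨hle.1, (add_le_add_iff_right δ).1 hle2⟩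
    have hmemO : ∀ p ∈ O.map t, ∃ p' ∈ A, ¬ (a ≤ p'.1 ∧ p'.1 < a + r) ∧ p'.1 = p.1 ∧
        p'.2 + δ = p.2 := by
      intro p hp
      obtain ⟨p', hp', rfl⟩ := Finset.mem_map.1 hp
      obtain ⟨hpA, hpn⟩ := Finset.mem_filter.1 hp'
      have := hcolA p' hpA
      exact ⟨p', hpA, by omega, rfl, rfl⟩
    obtain ⟨h1, h2⟩ := isAntichain_union hOt hB fun p hp q hq => by
      obtain ⟨p', hpA, hpn, e1, e2⟩ := hmemO p hp
      obtain ⟨hq1, -, ⟨u, hu, hu'⟩, ⟨v, hv, hv'⟩⟩ := hB' q hq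
      obtain ⟨huA, hur⟩ := Finset.mem_filter.1 hu
      obtain ⟨hvA, hvr⟩ := Finset.mem_filter.1 hv
      have e3 := hinc p' hpA u huA (by rintro rfl; exact hpn ⟨hur.1, hur.2.1⟩)
      have e4 := hinc p' hpA v hvA (by rintro rfl; exact hpn ⟨hvr.1, hvr.2.1⟩)
      omega
    rw [Finset.card_map] at h2
    refine ⟨O.map t ∪ B, ⟨⟨min i₁ a, max i₂ (a + r), j₁ + δ, j₂ + δ, ?_, ?_⟩, h1, ?_⟩,
      by omega⟩
    -- Now the columns of `N` are convex, and each contains the rows of `R` as well as those of the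
    -- shifted enclosing rectangle.
    · intro i j hi hi' hj hj'
      have hj0 := hcol (j - δ) (by omega) (by omega)
      have hconn := hN.down_convex j
      have m1 : ∀ i, a ≤ i → i < a + r → i ∈ downDiagonal N j := fun i hi hi' =>
        hrectN i j hi hi' (by omega) (by omega)
      have m2 : ∀ i, i₁ ≤ i → i < i₂ → i ∈ downDiagonal N j := fun i hi hi' => by
        by_cases hia : a ≤ i ∧ i < a + r
        · exact m1 i hia.1 hia.2
        · have := (h.outside i (j - δ) hia).1 (hM i _ hi hi' (by omega) (by omega))
          rwa [sub_add_cancel] at this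
      rcases lt_or_ge i a with h3 | h3
      · exact hconn.out (m2 i₁ le_rfl (by omega)) (m1 a le_rfl (by omega)) ⟨by omega, by omega⟩
      · rcases lt_or_ge i (a + r) with h4 | h4
        · exact m1 i h3 h4
        · exact hconn.out (m1 a le_rfl (by omega)) (m2 (i₂ - 1) (by omega) (by omega))
            ⟨by omega, by omega⟩
    · intro p hp
      rcases Finset.mem_union.1 hp with hp | hp
      · obtain ⟨p', hpA, hpn, e1, e2⟩ := hmemO p hp
        have e3 := hAr p' hpA
        omega
      · obtain ⟨hq1, -, ⟨u, hu, hu'⟩, ⟨v, hv, hv'⟩⟩ := hB' p hp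
        obtain ⟨huA, hur⟩ := Finset.mem_filter.1 hu
        obtain ⟨hvA, hvr⟩ := Finset.mem_filter.1 hv
        have e1 := hAr u huA
        have e2 := hAr v hvA
        omega
    · intro p hp
      rcases Finset.mem_union.1 hp with hp | hp
      · obtain ⟨p', hpA, hpn, e1, e2⟩ := hmemO p hp
        have := hf p' hpA
        rwa [show p' = (p'.1, p'.2) from rfl, hout p'.1 p'.2 hpn, e1, e2] at this
      · exact (hB' p hp).2.1

theorem IsRowShift.sameChains {M N : Finset (ℤ × ℤ)} {a c : ℤ} {r s : ℕ}
    (h : IsRowShift M N a c r s (-1)) (hM : IsMoon M) (hN : IsMoon N) (hr : 0 < r) (hs : 0 < s)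
    {f g : ℤ × ℤ → ℝ}
    (hin : ∀ i j, a ≤ i → i < a + r → ¬ (c ≤ j ∧ j < c + s) → f (i, j) = g (i, j))
    (hout : ∀ i j, ¬ (a ≤ i ∧ i < a + r) → f (i, j) = g (i, j - 1))
    (hfg : ShiftsChains f g a c r s) : SameChains M N f g := by
  intro k
  constructor
  · rintro ⟨A, hA, rfl⟩
    refine h.exists_isChainIn hN hr hs hin (fun i j hi => hout i j hi)
      (fun i₁ i₂ k h1 h2 h3 h4 => (hfg.rows i₁ i₂ k h1 h2 h3 h4).1)
      (fun j₁ j₂ k h1 h2 h3 h4 h5 => (hfg.columns j₁ j₂ k ?_ ?_ ?_ h4).1) hA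
    all_goals omega
  · rintro ⟨A, hA, rfl⟩
    have h' := h.symm
    rw [neg_neg] at h'
    refine h'.exists_isChainIn hM hr hs (fun i j h1 h2 h3 => (hin i j h1 h2 h3).symm)
      (fun i j hi => ?_)
      (fun i₁ i₂ k h1 h2 h3 h4 => (hfg.rows i₁ i₂ k h1 h2 h3 h4).2)
      (fun j₁ j₂ k h1 h2 h3 h4 h5 hk => (hfg.columns (j₁ + 1) (j₂ + 1) k ?_ ?_ ?_ h5).2 ?_) hA
    · rw [hout i (j + 1) hi, add_sub_cancel_right]
    · omega
    · omega
    · omega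
    · rwa [add_sub_cancel_right, add_sub_cancel_right]

/-! ### Shifts of moon polyominoes -/

/-- Comparability of rows as a condition on four boxes. In this form it is symmetric in the two
coordinates, so it also gives comparability of columns. -/
theorem IsMoon.mem_or_mem {M : Finset (ℤ × ℤ)} (hM : IsMoon M) {i j i' j' : ℤ} (h : (i, j) ∈ M)
    (h' : (i', j') ∈ M) : (i, j') ∈ M ∨ (i', j) ∈ M :=
  (hM.intersection_free i i').symm.imp (fun hs => hs h') (fun hs => hs h)

theorem IsMoon.of_mem_or_mem {M : Finset (ℤ × ℤ)} (h₁ : ∀ i, (upDiagonal M i).OrdConnected)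
    (h₂ : ∀ j, (downDiagonal M j).OrdConnected)
    (h₃ : ∀ i j i' j', (i, j) ∈ M → (i', j') ∈ M → (i, j') ∈ M ∨ (i', j) ∈ M) : IsMoon M := by
  refine ⟨h₁, h₂, fun i i' => ?_⟩
  by_contra! hcon
  obtain ⟨h, h'⟩ := hcon
  obtain ⟨j, hj, hj'⟩ := Set.not_subset.1 h
  obtain ⟨k, hk, hk'⟩ := Set.not_subset.1 h'
  rcases h₃ i j i' k hj hk with h | h
  exacts [hk' h, hj' h]

theorem IsMoon.transpose {M : Finset (ℤ × ℤ)} (hM : IsMoon M) : IsMoon (transpose M) := by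
  refine IsMoon.of_mem_or_mem (fun i => ?_) (fun j => ?_) ?_
  · convert hM.down_convex i using 1
    ext j
    exact mem_transpose
  · convert hM.up_convex j using 1
    ext i
    exact mem_transpose
  · intro i j i' j' h h'
    rw [mem_transpose] at *
    rw [mem_transpose]
    exact (hM.mem_or_mem h h').symm

section MaximalRect

variable {M N : Finset (ℤ × ℤ)} {a c : ℤ} {r s : ℕ}

theorem IsMaximalRect.mem (h : IsMaximalRect M a c r s) {i j : ℤ} (hi : a ≤ i) (hi' : i < a + r)
    (hj : c ≤ j) (hj' : j < c + s) : (i, j) ∈ M :=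
  h.subset (mem_rect.2 ⟨hi, hi', hj, hj'⟩)

theorem IsMaximalRect.transpose (h : IsMaximalRect M a c r s) :
    IsMaximalRect (transpose M) c a s r := by
  have hrect : ∀ a c r s, rect c a s r = MoonPolyomino.transpose (rect a c r s) := by
    intro a c r s
    ext ⟨i, j⟩
    rw [mem_transpose, mem_rect, mem_rect]
    simp only
    omega
  have hsub : ∀ {A B : Finset (ℤ × ℤ)}, MoonPolyomino.transpose A ⊆ MoonPolyomino.transpose B ↔
      A ⊆ B := fun {A B} => Finset.map_subset_map
  refine ⟨h.s_pos, h.r_pos, ?_, fun a' c' r' s' h1 h2 => ?_⟩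
  · rw [hrect, hsub]; exact h.subset
  · rw [hrect a c r s, hrect c' a' s' r', hsub] at h1
    rw [hrect c' a' s' r', hsub] at h2
    rw [hrect a c r s, hrect c' a' s' r', h.maximal c' a' s' r' h1 h2]

/-- No up-diagonal outside of a maximal rectangle extends it. -/
theorem IsMaximalRect.exists_notMem_row (hM : IsMoon M) (h : IsMaximalRect M a c r s) {i : ℤ}
    (hi : ¬ (a ≤ i ∧ i < a + r)) : ∃ j, c ≤ j ∧ j < c + s ∧ (i, j) ∉ M := by
  by_contra! hcon
  have hr := h.r_pos
  have hs := h.s_pos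
  -- The candidate for a larger rectangle is spanned by `R` and row `i`; convexity of columns fills
  -- any gap.
  have key := h.maximal (min a i) c (max (a + r) (i + 1) - min a i).toNat s (fun p hp => by
    rw [mem_rect] at hp ⊢; omega) (fun p hp => ?_)
  · have : (i, c) ∈ rect a c r s := by
      rw [← key, mem_rect]
      simp only
      omega
    rw [mem_rect] at this
    simp only at this
    omega
  · rw [mem_rect] at hp
    obtain ⟨h1, h2, h3, h4⟩ := hp
    have hconn := hM.down_convex p.2
    have m1 : ∀ i, a ≤ i → i < a + r → i ∈ downDiagonal M p.2 := fun i hi hi' =>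
      h.mem hi hi' h3 h4
    have m2 : i ∈ downDiagonal M p.2 := hcon p.2 h3 h4
    rcases lt_or_ge p.1 a with h5 | h5
    · exact hconn.out m2 (m1 a le_rfl (by omega)) ⟨by omega, by omega⟩
    · rcases lt_or_ge p.1 (a + r) with h6 | h6
      · exact m1 _ h5 h6
      · exact hconn.out (m1 a le_rfl (by omega)) m2 ⟨by omega, by omega⟩

theorem IsMaximalRect.exists_notMem_column (hM : IsMoon M) (h : IsMaximalRect M a c r s) {j : ℤ}
    (hj : ¬ (c ≤ j ∧ j < c + s)) : ∃ i, a ≤ i ∧ i < a + r ∧ (i, j) ∉ M := by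
  obtain ⟨i, h1, h2, h3⟩ := h.transpose.exists_notMem_row hM.transpose hj
  exact ⟨i, h1, h2, fun h4 => h3 (mem_transpose.2 h4)⟩

theorem IsDownShift.mem_iff (h : IsDownShift M N a c r s) {i j : ℤ} :
    (i, j) ∈ N ↔
      ((i, j) ∈ M ∧ ¬ ((c ≤ j ∧ j < c + s) ∧ ¬ (a ≤ i ∧ i < a + r))) ∨
        ((i, j + 1) ∈ M ∧ (c ≤ j + 1 ∧ j + 1 < c + s) ∧ ¬ (a ≤ i ∧ i < a + r)) := by
  rw [h.2, Finset.mem_image]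
  simp only [Finset.mem_Ico, mem_rect]
  constructor
  · rintro ⟨⟨i', j'⟩, hM, he⟩
    split_ifs at he with hc
    · simp only [Prod.mk.injEq] at he hc
      obtain ⟨rfl, rfl⟩ := he
      rw [sub_add_cancel]
      exact Or.inr ⟨hM, by omega, by omega⟩
    · simp only [Prod.mk.injEq] at he hc
      obtain ⟨rfl, rfl⟩ := he
      exact Or.inl ⟨hM, by omega⟩
  · rintro (⟨hM, hc⟩ | ⟨hM, hc⟩)
    · refine ⟨(i, j), hM, if_neg ?_⟩
      simp only
      omega
    · refine ⟨(i, j + 1), hM, ?_⟩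
      rw [if_pos (by simp only; omega), add_sub_cancel_right]

/-- A box `(i, c)` outside of the rows of `R` would move to `(i, c - 1)`. By maximality some row
`i₀` of `R` misses column `c - 1`, so the rows `i` and `i₀` of `N` would be incomparable: row `i`
has lost column `c + s - 1`, which row `i₀` keeps. -/
theorem IsDownShift.mem_first (h : IsDownShift M N a c r s) (hM : IsMoon M) (hN : IsMoon N)
    {i : ℤ} (hi : (i, c) ∈ M) : a ≤ i ∧ i < a + r := by
  by_contra hia
  have hs := h.1.s_pos
  obtain ⟨i₀, h1, h2, h3⟩ := h.1.exists_notMem_column hM (j := c - 1) (by omega)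
  have m1 : (i, c - 1) ∈ N := h.mem_iff.2 (Or.inr (by
    rw [sub_add_cancel]; exact ⟨hi, by omega, hia⟩))
  have m2 : (i₀, c + s - 1) ∈ N := h.mem_iff.2 (Or.inl
    ⟨h.1.mem h1 h2 (by omega) (by omega), by omega⟩)
  rcases hN.mem_or_mem m1 m2 with m | m <;> rcases h.mem_iff.1 m with ⟨m, m'⟩ | ⟨m, m'⟩
  · omega
  · omega
  · exact h3 m
  · omega

/-- A row outside of `R` avoids column `c`. Being comparable to rows of `R`, which contain `c`, it
can only use columns common to all of them, and these are the columns of `R`. So the whole row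
moves. -/
theorem IsDownShift.isRowShift_of_mem_first (h : IsDownShift M N a c r s) (hM : IsMoon M)
    (hfirst : ∀ i, (i, c) ∈ M → a ≤ i ∧ i < a + r) : IsRowShift M N a c r s (-1) := by
  have hs := h.1.s_pos
  have hcol : ∀ i j, ¬ (a ≤ i ∧ i < a + r) → (i, j) ∈ M → c + 1 ≤ j ∧ j < c + s := by
    intro i j hi hij
    have hjc : j ≠ c := by
      rintro rfl
      exact hi (hfirst i hij)
    by_contra hj
    obtain ⟨i₀, h1, h2, h3⟩ := h.1.exists_notMem_column hM (j := j) (by omega)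
    rcases hM.mem_or_mem hij (h.1.mem h1 h2 le_rfl (by omega)) with m | m
    · exact hi (hfirst i m)
    · exact h3 m
  refine ⟨fun i j hi hi' => ?_, fun i j hi => ?_, fun i j hi hij => ?_,
    fun i j hi hi' hj hj' => h.1.mem hi hi' hj hj'⟩
  · rw [h.mem_iff]
    constructor
    · exact fun m => Or.inl ⟨m, by omega⟩
    · rintro (m | m)
      · exact m.1
      · omega
  · rw [h.mem_iff, neg_add_cancel_right]
    constructor
    · intro m
      have := hcol i j hi m
      exact Or.inr ⟨m, by omega, hi⟩
    · rintro (⟨m, m'⟩ | m)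
      · have := hcol i _ hi m
        omega
      · exact m.1
  · have := hcol i j hi hij
    omega

theorem IsDownShift.isRowShift (h : IsDownShift M N a c r s) (hM : IsMoon M) (hN : IsMoon N) :
    IsRowShift M N a c r s (-1) :=
  h.isRowShift_of_mem_first hM fun _ hi => h.mem_first hM hN hi

theorem isDownShift_transpose_iff :
    IsDownShift (transpose M) (transpose N) c a s r ↔ IsUpShift M N a c r s := by
  have himage : transpose (M.image (fun p =>
      if p.1 ∈ Finset.Ico a (a + r) ∧ p ∉ rect a c r s then (p.1 - 1, p.2) else p)) =
      (transpose M).image (fun p =>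
        if p.2 ∈ Finset.Ico a (a + r) ∧ p ∉ rect c a s r then (p.1, p.2 - 1) else p) := by
    ext ⟨i, j⟩
    rw [mem_transpose, Finset.mem_image, Finset.mem_image]
    constructor
    · rintro ⟨⟨i', j'⟩, hp, he⟩
      refine ⟨(j', i'), mem_transpose.2 hp, ?_⟩
      simp only [mem_rect, Finset.mem_Ico] at he ⊢
      split_ifs at he ⊢ <;> simp only [Prod.mk.injEq] at * <;> omega
    · rintro ⟨⟨i', j'⟩, hp, he⟩
      refine ⟨(j', i'), mem_transpose.1 hp, ?_⟩
      simp only [mem_rect, Finset.mem_Ico] at he ⊢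
      split_ifs at he ⊢ <;> simp only [Prod.mk.injEq] at * <;> omega
  constructor
  · intro h
    refine ⟨transpose_transpose M ▸ h.1.transpose, ?_⟩
    rw [← transpose_transpose N, h.2, ← himage, transpose_transpose]
  · intro h
    exact ⟨h.1.transpose, by rw [h.2, himage]⟩

theorem IsUpShift.transpose (h : IsUpShift M N a c r s) :
    IsDownShift (transpose M) (transpose N) c a s r :=
  isDownShift_transpose_iff.2 h

theorem IsDownShift.transpose (h : IsDownShift M N a c r s) :
    IsUpShift (transpose M) (transpose N) c a s r :=
  isDownShift_transpose_iff.1 (by rwa [transpose_transpose, transpose_transpose])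

end MaximalRect

/-! ### The maps of labelings -/

section Labels

variable {M N : Finset (ℤ × ℤ)} {a c : ℤ} {r s : ℕ}

theorem label_of_mem (x : Labeling M) {p : ℤ × ℤ} (h : p ∈ M) : label x p = x ⟨p, h⟩ := dif_pos h

theorem label_of_notMem (x : Labeling M) {p : ℤ × ℤ} (h : p ∉ M) : label x p = 0 := dif_neg h

theorem label_nonneg_iff {x : Labeling M} : (∀ p, 0 ≤ label x p) ↔ ∀ p, 0 ≤ x p := by
  constructor
  · rintro h ⟨p, hp⟩
    rw [← label_of_mem x hp]
    exact h p
  · intro h p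
    unfold label
    split_ifs
    exacts [h _, le_rfl]

/-- Apply `E` to the labels inside of a rectangle and fetch the other labels by `σ`. -/
noncomputable def rectMap (M N : Finset (ℤ × ℤ)) (a c : ℤ) (r s : ℕ)
    (E : Equiv.Perm (Fin r × Fin s → ℝ)) (σ : ℤ × ℤ → ℤ × ℤ) (x : Labeling M) : Labeling N :=
  fun p => if h : p.1 ∈ rect a c r s then E (restrict x a c r s) (rectIndex p.1 h)
    else label x (σ p.1)

theorem label_rectMap_of_notMem {E : Equiv.Perm (Fin r × Fin s → ℝ)} {σ : ℤ × ℤ → ℤ × ℤ}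
    (x : Labeling M) {p : ℤ × ℤ} (hp : p ∈ N) (h : p ∉ rect a c r s) :
    label (rectMap M N a c r s E σ x) p = label x (σ p) := by
  rw [label_of_mem _ hp, rectMap, dif_neg h]

theorem rectIndex_spec {p : ℤ × ℤ} (h : p ∈ rect a c r s) :
    (a + ((rectIndex p h).1.val : ℤ), c + ((rectIndex p h).2.val : ℤ)) = p := by
  have := mem_rect.1 h
  refine Prod.ext ?_ ?_ <;> simp only [rectIndex] <;> omega

theorem mem_rect_coe (u : Fin r × Fin s) :
    (a + (u.1.val : ℤ), c + (u.2.val : ℤ)) ∈ rect a c r s := by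
  have h1 := u.1.2
  have h2 := u.2.2
  rw [mem_rect]
  simp only
  omega

theorem rectIndex_coe (u : Fin r × Fin s)
    (h : (a + (u.1.val : ℤ), c + (u.2.val : ℤ)) ∈ rect a c r s) : rectIndex _ h = u := by
  refine Prod.ext (Fin.ext ?_) (Fin.ext ?_) <;> simp [rectIndex]

theorem label_rectMap_coe {E : Equiv.Perm (Fin r × Fin s → ℝ)} {σ : ℤ × ℤ → ℤ × ℤ}
    (hN : rect a c r s ⊆ N) (x : Labeling M) (u : Fin r × Fin s) :
    label (rectMap M N a c r s E σ x) (a + (u.1.val : ℤ), c + (u.2.val : ℤ)) =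
      E (restrict x a c r s) u := by
  rw [label_of_mem _ (hN (mem_rect_coe u)), rectMap, dif_pos (mem_rect_coe u), rectIndex_coe]

theorem rectMap_leftInverse {E : Equiv.Perm (Fin r × Fin s → ℝ)} {σ σ' : ℤ × ℤ → ℤ × ℤ}
    (hN : rect a c r s ⊆ N)
    (h : ∀ q ∈ M, q ∉ rect a c r s → σ' q ∈ N ∧ σ' q ∉ rect a c r s ∧ σ (σ' q) = q)
    (x : Labeling M) :
    rectMap N M a c r s E⁻¹ σ' (rectMap M N a c r s E σ x) = x := by
  funext ⟨q, hq⟩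
  by_cases hr : q ∈ rect a c r s
  · have h1 : restrict (rectMap M N a c r s E σ x) a c r s = E (restrict x a c r s) :=
      funext fun u => label_rectMap_coe hN x u
    have h2 : E⁻¹ (E (restrict x a c r s)) = restrict x a c r s := E.symm_apply_apply _
    rw [rectMap, dif_pos hr, h1, h2, restrict, rectIndex_spec, label_of_mem _ hq]
  · obtain ⟨h1, h2, h3⟩ := h q hq hr
    rw [rectMap, dif_neg hr]
    simp only
    rw [label_rectMap_of_notMem x h1 h2, h3, label_of_mem _ hq]

/-- The translation by `δ` of the down-diagonals in `[c, c + s)`. -/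
noncomputable def shiftColumns (c : ℤ) (s : ℕ) (δ : ℤ) (p : ℤ × ℤ) : ℤ × ℤ :=
  if p.2 ∈ Finset.Ico c (c + s) then (p.1, p.2 + δ) else p

theorem IsRowShift.shiftColumns_spec {δ : ℤ} (h : IsRowShift M N a c r s δ) {q : ℤ × ℤ}
    (hq : q ∈ M) (hqr : ¬ (a ≤ q.1 ∧ q.1 < a + r ∧ c ≤ q.2 ∧ q.2 < c + s)) :
    shiftColumns c s δ q ∈ N ∧ (¬ (a ≤ (shiftColumns c s δ q).1 ∧
      (shiftColumns c s δ q).1 < a + r ∧ c ≤ (shiftColumns c s δ q).2 ∧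
        (shiftColumns c s δ q).2 < c + s)) ∧
      shiftColumns c s (-δ) (shiftColumns c s δ q) = q := by
  obtain ⟨i, j⟩ := q
  simp only [shiftColumns, Finset.mem_Ico] at *
  by_cases hj : c ≤ j ∧ j < c + s
  · have hi : ¬ (a ≤ i ∧ i < a + r) := by omega
    have h2 := h.columns i j hi hq
    rw [if_pos hj]
    refine ⟨(h.outside i j hi).1 hq, by simp only; omega, ?_⟩
    rw [if_pos (by simp only; omega), add_neg_cancel_right]
  · have hi : a ≤ i ∧ i < a + r := by
      by_contra hi
      exact hj (by have := h.columns i j hi hq; omega)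
    simp only [if_neg hj]
    exact ⟨(h.inside i j hi.1 hi.2).1 hq, hqr, trivial⟩

theorem IsDownShift.rect_subset (h : IsDownShift M N a c r s) : rect a c r s ⊆ N := by
  rintro ⟨i, j⟩ hp
  have := mem_rect.1 hp
  exact h.mem_iff.2 (Or.inl ⟨h.1.subset hp, by omega⟩)

theorem IsUpShift.rect_subset (h : IsUpShift M N a c r s) : rect a c r s ⊆ N := by
  rintro ⟨i, j⟩ hp
  have := mem_rect.1 hp
  refine mem_transpose.1 (h.transpose.rect_subset (mem_rect.2 ?_))
  simp only at *
  omega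

theorem omegaDown_eq_rectMap : omegaDown M N a c r s =
    rectMap M N a c r s (omegaP r s) (shiftColumns c s 1) := by
  funext x p
  unfold omegaDown rectMap shiftColumns
  split_ifs <;> rfl

theorem omegaUp_eq_rectMap : omegaUp M N a c r s =
    rectMap M N a c r s (omegaQ r s) (fun p => (shiftColumns a r 1 p.swap).swap) := by
  funext x p
  unfold omegaUp rectMap shiftColumns
  simp only [Prod.snd_swap]
  split_ifs <;> rfl

/-- The inverse is again a `rectMap`, with the inverse permutation inside of the rectangle and the
opposite shift outside. -/
theorem exists_isOmega_of_isDownShift (hM : IsMoon M) (hN : IsMoon N)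
    (h : IsDownShift M N a c r s) : ∃ e : Labeling M ≃ Labeling N, IsOmega M N e := by
  have hs := h.isRowShift hM hN
  refine ⟨⟨rectMap M N a c r s (omegaP r s) (shiftColumns c s 1),
    rectMap N M a c r s (omegaP r s)⁻¹ (shiftColumns c s (-1)),
    rectMap_leftInverse h.rect_subset fun q hq hqr => ?_, fun y => ?_⟩,
    IsOmega.down hM hN a c r s h _ fun x => by rw [omegaDown_eq_rectMap]; rfl⟩
  · rw [mem_rect] at hqr ⊢
    simpa using hs.shiftColumns_spec hq hqr
  · have := rectMap_leftInverse (E := (omegaP r s)⁻¹) (σ := shiftColumns c s (-1))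
      (σ' := shiftColumns c s 1) h.1.subset (fun q hq hqr => ?_) y
    · rwa [inv_inv] at this
    · rw [mem_rect] at hqr ⊢
      simpa using hs.symm.shiftColumns_spec hq hqr

theorem exists_isOmega_of_isUpShift (hM : IsMoon M) (hN : IsMoon N)
    (h : IsUpShift M N a c r s) : ∃ e : Labeling M ≃ Labeling N, IsOmega M N e := by
  have hs := h.transpose.isRowShift hM.transpose hN.transpose
  have key : ∀ {M N : Finset (ℤ × ℤ)} {δ : ℤ},
      IsRowShift (transpose M) (transpose N) c a s r δ → ∀ q ∈ M, q ∉ rect a c r s →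
        (shiftColumns a r δ q.swap).swap ∈ N ∧
          (shiftColumns a r δ q.swap).swap ∉ rect a c r s ∧
          (shiftColumns a r (-δ) (shiftColumns a r δ q.swap).swap.swap).swap = q := by
    intro M N δ hs q hq hqr
    rw [mem_rect] at hqr ⊢
    obtain ⟨h1, h2, h3⟩ := hs.shiftColumns_spec (q := q.swap) (mem_transpose.2 hq)
      (by simp only [Prod.fst_swap, Prod.snd_swap]; omega)
    refine ⟨mem_transpose.1 h1, ?_, ?_⟩
    · simp only [Prod.fst_swap, Prod.snd_swap]
      omega
    · rw [Prod.swap_swap, h3, Prod.swap_swap]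
  refine ⟨⟨rectMap M N a c r s (omegaQ r s) (fun p => (shiftColumns a r 1 p.swap).swap),
    rectMap N M a c r s (omegaQ r s)⁻¹ (fun p => (shiftColumns a r (-1) p.swap).swap),
    rectMap_leftInverse h.rect_subset fun q hq hqr => ?_, fun y => ?_⟩,
    IsOmega.up hM hN a c r s h _ fun x => by rw [omegaUp_eq_rectMap]; rfl⟩
  · simpa using key hs q hq hqr
  · have := rectMap_leftInverse (E := (omegaQ r s)⁻¹)
      (σ := fun p => (shiftColumns a r (-1) p.swap).swap)
      (σ' := fun p => (shiftColumns a r 1 p.swap).swap) h.1.subset (fun q hq hqr => ?_) y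
    · rwa [inv_inv] at this
    · simpa using key hs.symm q hq hqr

theorem IsRowShift.nonneg_iff {f g : ℤ × ℤ → ℝ}
    (hin : ∀ i j, a ≤ i → i < a + r → ¬ (c ≤ j ∧ j < c + s) → f (i, j) = g (i, j))
    (hout : ∀ i j, ¬ (a ≤ i ∧ i < a + r) → f (i, j) = g (i, j - 1))
    (hR : (∀ i j, a ≤ i → i < a + r → c ≤ j → j < c + s → 0 ≤ f (i, j)) ↔
      ∀ i j, a ≤ i → i < a + r → c ≤ j → j < c + s → 0 ≤ g (i, j)) :
    (∀ p, 0 ≤ f p) ↔ ∀ p, 0 ≤ g p := by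
  constructor
  · rintro h ⟨i, j⟩
    by_cases hi : a ≤ i ∧ i < a + r
    · by_cases hj : c ≤ j ∧ j < c + s
      · exact hR.1 (fun i j _ _ _ _ => h (i, j)) i j hi.1 hi.2 hj.1 hj.2
      · rw [← hin i j hi.1 hi.2 hj]; exact h _
    · have := hout i (j + 1) hi
      rw [add_sub_cancel_right] at this
      rw [← this]; exact h _
  · rintro h ⟨i, j⟩
    by_cases hi : a ≤ i ∧ i < a + r
    · by_cases hj : c ≤ j ∧ j < c + s
      · exact hR.2 (fun i j _ _ _ _ => h (i, j)) i j hi.1 hi.2 hj.1 hj.2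
      · rw [hin i j hi.1 hi.2 hj]; exact h _
    · rw [hout i j hi]; exact h _

theorem forall_rect_iff {f : ℤ × ℤ → ℝ} :
    (∀ i j, a ≤ i → i < a + r → c ≤ j → j < c + s → 0 ≤ f (i, j)) ↔
      ∀ u : Fin r × Fin s, 0 ≤ f (a + (u.1.val : ℤ), c + (u.2.val : ℤ)) := by
  constructor
  · intro h u
    have := u.1.2
    have := u.2.2
    exact h _ _ (by omega) (by omega) (by omega) (by omega)
  · intro h i j h1 h2 h3 h4
    have := h (rectIndex (i, j) (mem_rect.2 ⟨h1, h2, h3, h4⟩))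
    rwa [rectIndex_spec] at this

theorem omegaDown_invariant (hM : IsMoon M) (hN : IsMoon N) (h : IsDownShift M N a c r s)
    (x : Labeling M) :
    ((∀ p, 0 ≤ label x p) ↔ ∀ p, 0 ≤ label (omegaDown M N a c r s x) p) ∧
      ((∀ p, 0 ≤ label x p) →
        SameChains M N (label x) (label (omegaDown M N a c r s x))) := by
  have hs := h.isRowShift hM hN
  rw [omegaDown_eq_rectMap]
  -- Both comparisons hold on the whole plane, because labels off the polyominoes are `0` on both
  -- sides.
  have hin : ∀ i j, a ≤ i → i < a + r → ¬ (c ≤ j ∧ j < c + s) → label x (i, j) =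
      label (rectMap M N a c r s (omegaP r s) (shiftColumns c s 1) x) (i, j) := by
    intro i j hi hi' hj
    by_cases hp : (i, j) ∈ N
    · rw [label_rectMap_of_notMem x hp (by rw [mem_rect]; simp only; omega), shiftColumns,
        if_neg (by simpa using hj)]
    · rw [label_of_notMem _ hp, label_of_notMem _ (by rwa [hs.inside i j hi hi'])]
  have hout : ∀ i j, ¬ (a ≤ i ∧ i < a + r) → label x (i, j) =
      label (rectMap M N a c r s (omegaP r s) (shiftColumns c s 1) x) (i, j + -1) := by
    intro i j hi
    by_cases hp : (i, j) ∈ M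
    · have hj := hs.columns i j hi hp
      rw [label_rectMap_of_notMem x ((hs.outside i j hi).1 hp)
        (by rw [mem_rect]; simp only; omega), shiftColumns,
        if_pos (by rw [Finset.mem_Ico]; simp only; omega), neg_add_cancel_right]
    · rw [label_of_notMem _ hp, label_of_notMem _ fun h' => hp ((hs.outside i j hi).2 h')]
  have hR := fun u => label_rectMap_coe (E := omegaP r s) (σ := shiftColumns c s 1)
    h.rect_subset x u
  constructor
  · refine IsRowShift.nonneg_iff hin hout ?_
    rw [forall_rect_iff, forall_rect_iff]
    simp only [hR]
    exact omegaP_nonneg_iff (restrict x a c r s)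
  · intro hx
    exact hs.sameChains hM hN h.1.r_pos h.1.s_pos hin hout
      (shiftsChains_omegaP (fun u => hx _) (fun u => rfl) hR)

theorem omegaUp_invariant (hM : IsMoon M) (hN : IsMoon N) (h : IsUpShift M N a c r s)
    (x : Labeling M) :
    ((∀ p, 0 ≤ label x p) ↔ ∀ p, 0 ≤ label (omegaUp M N a c r s x) p) ∧
      ((∀ p, 0 ≤ label x p) →
        SameChains M N (label x) (label (omegaUp M N a c r s x))) := by
  have hs := h.transpose.isRowShift hM.transpose hN.transpose
  rw [omegaUp_eq_rectMap]
  set y : Labeling N :=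
    rectMap M N a c r s (omegaQ r s) (fun p => (shiftColumns a r 1 p.swap).swap) x with hy
  have hin : ∀ j i, c ≤ j → j < c + s → ¬ (a ≤ i ∧ i < a + r) →
      (fun p => label x p.swap) (j, i) = (fun p => label y p.swap) (j, i) := by
    intro j i hj hj' hi
    simp only [Prod.swap_prod_mk]
    by_cases hp : (i, j) ∈ N
    · rw [hy, label_rectMap_of_notMem x hp (by rw [mem_rect]; simp only; omega), shiftColumns,
        if_neg (by simpa using hi)]
      rfl
    · rw [label_of_notMem _ hp, label_of_notMem _ fun h' => hp
        (mem_transpose.1 ((hs.inside j i hj hj').1 (mem_transpose.2 h')))]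
  have hout : ∀ j i, ¬ (c ≤ j ∧ j < c + s) →
      (fun p => label x p.swap) (j, i) = (fun p => label y p.swap) (j, i + -1) := by
    intro j i hj
    simp only [Prod.swap_prod_mk]
    by_cases hp : (i, j) ∈ M
    · have hi := hs.columns j i hj (mem_transpose.2 hp)
      rw [hy, label_rectMap_of_notMem x
        (mem_transpose.1 ((hs.outside j i hj).1 (mem_transpose.2 hp)))
        (by rw [mem_rect]; simp only; omega), shiftColumns,
        if_pos (by rw [Finset.mem_Ico]; simp only [Prod.snd_swap]; omega)]
      simp
    · rw [label_of_notMem _ hp, label_of_notMem _ fun h' => hp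
        (mem_transpose.1 ((hs.outside j i hj).2 (mem_transpose.2 h')))]
  have hR := fun u => label_rectMap_coe (E := omegaQ r s)
    (σ := fun p => (shiftColumns a r 1 p.swap).swap) h.rect_subset x u
  constructor
  · have hswap : ∀ f : ℤ × ℤ → ℝ, (∀ p, 0 ≤ f p) ↔ ∀ p : ℤ × ℤ, 0 ≤ f p.swap :=
      fun f => ⟨fun h p => h _, fun h p => h p.swap⟩
    rw [hswap, hswap (label y)]
    refine IsRowShift.nonneg_iff hin hout ?_
    have hrect : ∀ f : ℤ × ℤ → ℝ,
        (∀ j i, c ≤ j → j < c + s → a ≤ i → i < a + r → 0 ≤ f (i, j)) ↔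
          ∀ u : Fin r × Fin s, 0 ≤ f (a + (u.1.val : ℤ), c + (u.2.val : ℤ)) := by
      intro f
      rw [← forall_rect_iff]
      exact ⟨fun h i j h1 h2 h3 h4 => h j i h3 h4 h1 h2,
        fun h i j h1 h2 h3 h4 => h j i h3 h4 h1 h2⟩
    refine (hrect (label x)).trans (Iff.trans ?_ (hrect (label y)).symm)
    simp only [hy, hR]
    exact omegaQ_nonneg_iff (restrict x a c r s)
  · intro hx
    rw [← sameChains_transpose]
    exact hs.sameChains hM.transpose hN.transpose h.1.s_pos h.1.r_pos hin hout
      (shiftsChains_omegaQ (fun u => hx _) (fun u => rfl) hR)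

end Labels

theorem sameChains_translate {M N : Finset (ℤ × ℤ)} {v : ℤ × ℤ}
    (h : N = M.image (fun p => p + v)) {f g : ℤ × ℤ → ℝ} (hfg : ∀ p, g (p + v) = f p) :
    SameChains M N f g := by
  have key : ∀ {M N : Finset (ℤ × ℤ)} {f g : ℤ × ℤ → ℝ} {v : ℤ × ℤ},
      (∀ p, p ∈ M → p + v ∈ N) → (∀ p, g (p + v) = f p) → ∀ {A}, IsChainIn M f A →
      ∃ B, IsChainIn N g B ∧ B.card = A.card := by
    rintro M N f g v hMN hfg A ⟨⟨i₁, i₂, j₁, j₂, h1, h2⟩, h3, h4⟩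
    refine ⟨A.map (addRightEmbedding v), ⟨⟨i₁ + v.1, i₂ + v.1, j₁ + v.2, j₂ + v.2, ?_, ?_⟩, ?_, ?_⟩,
      Finset.card_map _⟩
    · intro i j ha hb hc hd
      have := hMN _ (h1 (i - v.1) (j - v.2) (by omega) (by omega) (by omega) (by omega))
      rwa [show ((i - v.1, j - v.2) : ℤ × ℤ) + v = (i, j) from
        Prod.ext (sub_add_cancel _ _) (sub_add_cancel _ _)] at this
    · intro p hp
      obtain ⟨q, hq, rfl⟩ := Finset.mem_map.1 hp
      have := h2 q hq
      simp only [addRightEmbedding_apply, Prod.fst_add, Prod.snd_add]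
      omega
    · intro p hp q hq hpq hle
      obtain ⟨p', hp', rfl⟩ := Finset.mem_map.1 hp
      obtain ⟨q', hq', rfl⟩ := Finset.mem_map.1 hq
      exact h3 hp' hq' (fun h => hpq (by rw [h])) ((add_le_add_iff_right v).1 hle)
    · intro p hp
      obtain ⟨q, hq, rfl⟩ := Finset.mem_map.1 hp
      rw [addRightEmbedding_apply, hfg]
      exact h4 q hq
  intro k
  constructor
  · rintro ⟨A, hA, rfl⟩
    exact key (fun p hp => by rw [h]; exact Finset.mem_image_of_mem _ hp) hfg hA
  · rintro ⟨A, hA, rfl⟩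
    refine key (v := -v) (fun p hp => ?_) (fun p => ?_) hA
    · rw [h] at hp
      obtain ⟨q, hq, rfl⟩ := Finset.mem_image.1 hp
      rwa [add_neg_cancel_right]
    · rw [← hfg, neg_add_cancel_right]

/-- The equivalence for nonnegativity is carried along so that the induction passes through inverses
and compositions. -/
theorem IsOmega.invariant {M N : Finset (ℤ × ℤ)} {e : Labeling M ≃ Labeling N}
    (h : IsOmega M N e) (x : Labeling M) :
    ((∀ p, 0 ≤ x p) ↔ ∀ p, 0 ≤ e x p) ∧
      ((∀ p, 0 ≤ x p) → longestSE (e x) = longestSE x) := by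
  induction h with
  | down hM hN a c r s h e he =>
    rw [he, ← label_nonneg_iff, ← label_nonneg_iff]
    exact ⟨(omegaDown_invariant hM hN h x).1,
      fun hx => ((omegaDown_invariant hM hN h x).2 hx).longestSE_eq.symm⟩
  | up hM hN a c r s h e he =>
    rw [he, ← label_nonneg_iff, ← label_nonneg_iff]
    exact ⟨(omegaUp_invariant hM hN h x).1,
      fun hx => ((omegaUp_invariant hM hN h x).2 hx).longestSE_eq.symm⟩
  | translate hM v h e he =>
    refine ⟨?_, fun _ => (sameChains_translate h (he x)).longestSE_eq.symm⟩
    rw [← label_nonneg_iff, ← label_nonneg_iff]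
    refine ⟨fun hx p => ?_, fun hx p => ?_⟩
    · rw [← sub_add_cancel p v, he]; exact hx _
    · rw [← he]; exact hx _
  | @symm M N e h ih =>
    have := ih (e.symm x)
    rw [e.apply_symm_apply] at this
    exact ⟨this.1.symm, fun hx => (this.2 (this.1.2 hx)).symm⟩
  | @trans M N K e f h₁ h₂ ih₁ ih₂ =>
    have h1 := ih₁ x
    have h2 := ih₂ (e x)
    exact ⟨h1.1.trans h2.1, fun hx => (h2.2 (h1.1.1 hx)).trans (h1.2 hx)⟩

/-! ### Connecting equivalent moon polyominoes -/

theorem exists_eq_interval {S : Set ℤ} (hS : S.OrdConnected) (hfin : S.Finite)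
    (hne : S.Nonempty) : ∃ (a : ℤ) (r : ℕ), 0 < r ∧ ∀ i, i ∈ S ↔ a ≤ i ∧ i < a + r := by
  obtain ⟨a, ha, hmin⟩ := S.exists_min_image id hfin hne
  obtain ⟨b, hb, hmax⟩ := S.exists_max_image id hfin hne
  have hab : a ≤ b := hmin b hb
  refine ⟨a, (b + 1 - a).toNat, by omega, fun i => ⟨fun hi => ?_, fun hi => ?_⟩⟩
  · have h1 : a ≤ i := hmin i hi
    have h2 : i ≤ b := hmax i hi
    omega
  · exact hS.out ha hb ⟨by omega, by omega⟩

theorem finite_downDiagonal (M : Finset (ℤ × ℤ)) (j : ℤ) : (downDiagonal M j).Finite :=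
  (M.image Prod.fst).finite_toSet.subset fun _ hi =>
    Finset.mem_coe.2 (Finset.mem_image_of_mem Prod.fst hi)

/-- Columns are nested, so one of maximal cardinality contains all the others. -/
theorem IsMoon.exists_max_column {M : Finset (ℤ × ℤ)} (hM : IsMoon M) (hne : M.Nonempty) :
    ∃ p₀ ∈ M, ∀ p ∈ M, (p.1, p₀.2) ∈ M := by
  obtain ⟨p₀, hp₀, hmax⟩ := M.exists_max_image (fun p => (downDiagonal M p.2).ncard) hne
  refine ⟨p₀, hp₀, fun p hp => ?_⟩
  by_contra hnot
  refine absurd (hmax p hp) (not_le.2 (Set.ncard_lt_ncard ?_ (finite_downDiagonal M p.2)))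
  refine ⟨fun i hi => ?_, fun hsub => hnot (hsub hp)⟩
  exact (hM.mem_or_mem (show (p.1, p.2) ∈ M from hp) hi).resolve_left hnot

/-- Each row of `N` is a translate of a row of `M`, and each column of `N` is a column of `M` at
another place. The first gives convexity of rows, the second everything else. -/
theorem IsMoon.of_isRowShift {M N : Finset (ℤ × ℤ)} (hM : IsMoon M) {a c : ℤ} {r s : ℕ} {δ : ℤ}
    (h : IsRowShift M N a c r s δ) {π : Equiv.Perm ℤ} (hπ : ∀ i j, (i, j) ∈ M ↔ (i, π j) ∈ N) :
    IsMoon N := by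
  have hπ' : ∀ i j, (i, j) ∈ N ↔ (i, π.symm j) ∈ M := fun i j => by
    rw [hπ, Equiv.apply_symm_apply]
  refine IsMoon.of_mem_or_mem (fun i => ?_) (fun j => ?_) ?_
  · by_cases hi : a ≤ i ∧ i < a + r
    · convert hM.up_convex i using 1
      ext j
      exact (h.inside i j hi.1 hi.2).symm
    · refine ⟨fun j hj k hk l hl => ?_⟩
      have hout := fun j => h.symm.outside i j hi
      refine (hout l).2 ((hM.up_convex i).out ((hout j).1 hj) ((hout k).1 hk) ⟨?_, ?_⟩)
      · exact add_le_add_left hl.1 _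
      · exact add_le_add_left hl.2 _
  · convert hM.down_convex (π.symm j) using 1
    ext i
    exact hπ' i j
  · intro i j i' j' h1 h2
    rw [hπ'] at *
    rw [hπ']
    exact hM.mem_or_mem h1 h2

/-- The cyclic permutation of `[c, c + s)` that decreases all elements but `c`. -/
def rotation (c : ℤ) (s : ℕ) (hs : 0 < s) : Equiv.Perm ℤ where
  toFun j := if j = c then c + s - 1 else if c < j ∧ j < c + s then j - 1 else j
  invFun j := if j = c + s - 1 then c else if c ≤ j ∧ j < c + s - 1 then j + 1 else j
  left_inv j := by
    simp only
    split_ifs <;> omega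
  right_inv j := by
    simp only
    split_ifs <;> omega

/-- Rows meeting the rectangle contain all of its columns and do not notice the rotation. The other
rows avoid column `c`, and on them it acts as the shift. -/
theorem IsRowShift.mem_iff_rotation {M N : Finset (ℤ × ℤ)} {a c : ℤ} {r s : ℕ} (hs : 0 < s)
    (h : IsRowShift M N a c r s (-1)) (i j : ℤ) :
    (i, j) ∈ M ↔ (i, rotation c s hs j) ∈ N := by
  change _ ↔ (i, if j = c then c + s - 1 else if c < j ∧ j < c + s then j - 1 else j) ∈ N
  by_cases hi : a ≤ i ∧ i < a + r
  · rw [← h.inside i _ hi.1 hi.2]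
    split_ifs with h1 h2
    · exact iff_of_true (h.rect i j hi.1 hi.2 (by omega) (by omega))
        (h.rect i _ hi.1 hi.2 (by omega) (by omega))
    · exact iff_of_true (h.rect i j hi.1 hi.2 (by omega) (by omega))
        (h.rect i _ hi.1 hi.2 (by omega) (by omega))
    · exact Iff.rfl
  · have h1 := h.columns i j hi
    have h2 := fun j => h.symm.columns i j hi
    split_ifs with h3 h4
    · exact iff_of_false (fun m => by have := h1 m; omega) (fun m => by have := h2 _ m; omega)
    · exact h.outside i j hi
    · exact iff_of_false (fun m => by have := h1 m; omega) (fun m => by have := h2 _ m; omega)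

/-- The first down-diagonal of a moon polyomino can be shifted. -/
theorem IsMoon.exists_isDownShift {M : Finset (ℤ × ℤ)} (hM : IsMoon M) {c : ℤ}
    (hc : ∀ p ∈ M, c ≤ p.2) (hc' : ∃ i, (i, c) ∈ M) :
    ∃ (N : Finset (ℤ × ℤ)) (a : ℤ) (r s : ℕ), IsDownShift M N a c r s ∧
      IsRowShift M N a c r s (-1) ∧ ∀ i, (i, c) ∈ M ↔ a ≤ i ∧ i < a + r := by
  obtain ⟨a, r, hr, har⟩ := exists_eq_interval (hM.down_convex c) (finite_downDiagonal M c) hc'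
  have har' : ∀ i, (i, c) ∈ M ↔ a ≤ i ∧ i < a + r := har
  -- The rectangle consists of the rows of the first column and all columns that contain these rows.
  -- Being leftmost, it automatically starts in column `c`.
  obtain ⟨c', s, hs, hcs⟩ := exists_eq_interval (S := {j | ∀ i, a ≤ i → i < a + r → (i, j) ∈ M})
    ⟨fun j hj k hk l hl i hi hi' => (hM.up_convex i).out (hj i hi hi') (hk i hi hi') hl⟩
    ((finite_downDiagonal (MoonPolyomino.transpose M) a).subset fun j hj =>
      mem_transpose.2 (hj a le_rfl (by omega)))
    ⟨c, fun i hi hi' => (har' i).2 ⟨hi, hi'⟩⟩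
  simp only [Set.mem_ofPred_eq] at hcs
  obtain rfl : c = c' := by
    have h1 := (hcs c).1 fun i hi hi' => (har' i).2 ⟨hi, hi'⟩
    have h2 := hc _ ((hcs c').2 (by omega) a le_rfl (by omega))
    simp only at h2
    omega
  have hmax : IsMaximalRect M a c r s := by
    refine ⟨hr, hs, ?_, fun a' c' r' s' h1 h2 => ?_⟩
    · rintro ⟨i, j⟩ hp
      obtain ⟨h1, h2, h3, h4⟩ := mem_rect.1 hp
      exact (hcs j).2 ⟨h3, h4⟩ i h1 h2
    · refine Finset.Subset.antisymm ?_ h1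
      rintro ⟨i, j⟩ hp
      have h3 := mem_rect.1 hp
      have h4 : ∀ i₀, a ≤ i₀ → i₀ < a + r → (i₀, c) ∈ rect a' c' r' s' := fun i₀ hi hi' =>
        h1 (mem_rect.2 ⟨hi, hi', le_rfl, by simp only; omega⟩)
      have h5 := mem_rect.1 (h4 a le_rfl (by omega))
      have h6 := (har' i).1 (h2 (mem_rect.2 ⟨h3.1, h3.2.1, h5.2.2⟩))
      have h7 := (hcs j).1 fun i₀ hi hi' => h2 (by
        have := mem_rect.1 (h4 i₀ hi hi')
        exact mem_rect.2 ⟨this.1, this.2.1, h3.2.2⟩)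
      exact mem_rect.2 ⟨h6.1, h6.2, h7⟩
  have hshift : IsDownShift M (M.image (fun p =>
      if p.2 ∈ Finset.Ico c (c + s) ∧ p ∉ rect a c r s then (p.1, p.2 - 1) else p)) a c r s :=
    ⟨hmax, rfl⟩
  exact ⟨_, a, r, s, hshift,
    hshift.isRowShift_of_mem_first hM (fun i hi => (har' i).1 hi), har'⟩

/-- Shifts of down-diagonals make the first down-diagonal the largest one. -/
theorem IsMoon.exists_first_column_max {C : Finset (ℤ × ℤ) → Finset (ℤ × ℤ) → Prop}
    (hrefl : ∀ M, IsMoon M → C M M) (htrans : ∀ M N K, C M N → C N K → C M K)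
    (hC : ∀ M N a c r s, IsMoon M → IsMoon N → IsDownShift M N a c r s → C M N)
    {M : Finset (ℤ × ℤ)} (hM : IsMoon M) (hne : M.Nonempty) :
    ∃ N, C M N ∧ IsMoon N ∧ (∃ π : Equiv.Perm ℤ, ∀ i j, (i, j) ∈ M ↔ (i, π j) ∈ N) ∧
      ∃ c, ∀ p ∈ N, c ≤ p.2 ∧ (p.1, c) ∈ N := by
  -- Induction on the distance `m` from the first column to a column that contains all the others;
  -- each shift at the first column reduces it by one.
  have key : ∀ (m : ℕ) (M : Finset (ℤ × ℤ)) (c : ℤ), IsMoon M → (∀ p ∈ M, c ≤ p.2) →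
      (∃ i, (i, c) ∈ M) → (∀ p ∈ M, (p.1, c + m) ∈ M) →
      ∃ N, C M N ∧ IsMoon N ∧ (∃ π : Equiv.Perm ℤ, ∀ i j, (i, j) ∈ M ↔ (i, π j) ∈ N) ∧
        ∃ c, ∀ p ∈ N, c ≤ p.2 ∧ (p.1, c) ∈ N := by
    intro m
    induction m with
    | zero =>
      intro M c hM h1 _ h3
      exact ⟨M, hrefl M hM, hM, ⟨1, fun i j => Iff.rfl⟩, c, fun p hp =>
        ⟨h1 p hp, by simpa using h3 p hp⟩⟩
    | succ m ih =>
      intro M c hM h1 h2 h3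
      obtain ⟨N, a, r, s, hdown, hrow, har⟩ := hM.exists_isDownShift h1 h2
      have hs := hdown.1.s_pos
      have hr := hdown.1.r_pos
      have hN := hM.of_isRowShift hrow (hrow.mem_iff_rotation hs)
      -- The largest column contains the first one, so it passes through the maximal rectangle.
      have hms : (m : ℤ) + 1 < s := by
        by_contra hms
        obtain ⟨i, hi, hi', hn⟩ := hdown.1.exists_notMem_column hM (j := c + (m + 1)) (by omega)
        refine hn ?_
        simpa using h3 _ ((har i).2 ⟨hi, hi'⟩)
      have hfirst : ∀ p ∈ N, c ≤ p.2 := by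
        rintro ⟨i, j⟩ hp
        by_cases hi : a ≤ i ∧ i < a + r
        · exact h1 _ ((hrow.inside i j hi.1 hi.2).2 hp)
        · exact (hrow.symm.columns i j hi hp).1
      have hcol : ∃ i, (i, c) ∈ N := by
        exact ⟨a, (hrow.inside a c le_rfl (by omega)).1
          (hrow.rect a c le_rfl (by omega) le_rfl (by omega))⟩
      have hlast : ∀ p ∈ N, (p.1, c + m) ∈ N := by
        rintro ⟨i, j⟩ hp
        by_cases hi : a ≤ i ∧ i < a + r
        · exact (hrow.inside i _ hi.1 hi.2).1 (hrow.rect i _ hi.1 hi.2 (by omega) (by omega))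
        · have h4 := h3 _ ((hrow.symm.outside i j hi).1 hp)
          have h5 := (hrow.outside i _ hi).1 h4
          rwa [show c + ((m + 1 : ℕ) : ℤ) + -1 = c + m by push_cast; ring] at h5
      obtain ⟨K, hNK, hK, ⟨π, hπ⟩, hc⟩ := ih N c hN hfirst hcol hlast
      refine ⟨K, htrans M N K (hC M N a c r s hM hN hdown) hNK, hK,
        ⟨(rotation c s hs).trans π, fun i j => ?_⟩, hc⟩
      rw [hrow.mem_iff_rotation hs, hπ]
      rfl
  obtain ⟨p₁, hp₁, hmin⟩ := M.exists_min_image Prod.snd hne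
  obtain ⟨p₀, hp₀, hmax⟩ := hM.exists_max_column hne
  have := hmin p₀ hp₀
  refine key (p₀.2 - p₁.2).toNat M p₁.2 hM hmin ⟨p₁.1, hp₁⟩ fun p hp => ?_
  rw [show p₁.2 + ((p₀.2 - p₁.2).toNat : ℤ) = p₀.2 by omega]
  exact hmax p hp

theorem isOmega_refl {M : Finset (ℤ × ℤ)} (hM : IsMoon M) : IsOmega M M (Equiv.refl _) :=
  IsOmega.translate hM 0 (by simp) _ (by simp)

theorem exists_isOmega_translate {M : Finset (ℤ × ℤ)} (hM : IsMoon M) (v : ℤ × ℤ) :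
    ∃ e, IsOmega M (M.image (fun p => p + v)) e := by
  have hmem : ∀ p, p ∈ M ↔ p + v ∈ M.image (fun p => p + v) := fun p => by simp
  refine ⟨Equiv.arrowCongr ((Equiv.addRight v).subtypeEquiv hmem) (Equiv.refl ℝ),
    IsOmega.translate hM v rfl _ fun x p => ?_⟩
  by_cases hp : p ∈ M
  · rw [label_of_mem _ hp, label_of_mem _ ((hmem p).1 hp)]
    exact congrArg x (Equiv.symm_apply_apply ((Equiv.addRight v).subtypeEquiv hmem) ⟨p, hp⟩)
  · rw [label_of_notMem _ hp, label_of_notMem _ fun h => hp ((hmem p).2 h)]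

/-- Young diagrams whose corner is the origin. -/
def IsYoung (K : Finset (ℤ × ℤ)) : Prop :=
  (∀ p ∈ K, 0 ≤ p.1 ∧ 0 ≤ p.2) ∧
    ∀ i j i' j', (i, j) ∈ K → 0 ≤ i' → i' ≤ i → 0 ≤ j' → j' ≤ j → (i', j') ∈ K

/-- Columns are sorted first, then rows by the same argument on the transpose. With a largest first
row and a largest first column, convexity gives a Young diagram up to translation. -/
theorem IsMoon.exists_isYoung {M : Finset (ℤ × ℤ)} (hM : IsMoon M) (hne : M.Nonempty) :
    ∃ K, (∃ e, IsOmega M K e) ∧ IsYoung K ∧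
      ∃ σ τ : Equiv.Perm ℤ, ∀ i j, (i, j) ∈ M ↔ (σ i, τ j) ∈ K := by
  obtain ⟨N, ⟨e₁, he₁⟩, hN, ⟨τ, hτ⟩, c, hc⟩ :=
    IsMoon.exists_first_column_max (C := fun M N => ∃ e, IsOmega M N e)
      (fun M hM => ⟨_, isOmega_refl hM⟩)
      (fun M N K ⟨e, he⟩ ⟨f, hf⟩ => ⟨_, he.trans hf⟩)
      (fun M N a c r s hM hN h => exists_isOmega_of_isDownShift hM hN h) hM hne
  have hneN : (MoonPolyomino.transpose N).Nonempty := by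
    obtain ⟨⟨i, j⟩, hp⟩ := hne
    exact ⟨(τ j, i), mem_transpose.2 ((hτ i j).1 hp)⟩
  obtain ⟨K, ⟨e₂, he₂⟩, hK, ⟨σ, hσ⟩, a, ha⟩ :=
    IsMoon.exists_first_column_max (C := fun M N => ∃ e,
      IsOmega (MoonPolyomino.transpose M) (MoonPolyomino.transpose N) e)
      (fun M hM => ⟨_, isOmega_refl hM.transpose⟩)
      (fun M N K ⟨e, he⟩ ⟨f, hf⟩ => ⟨_, he.trans hf⟩)
      (fun M N a c r s hM hN h => exists_isOmega_of_isUpShift hM.transpose hN.transpose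
        h.transpose) hN.transpose hneN
  have hN' : ∃ e, IsOmega N (MoonPolyomino.transpose K) e := by
    have h : ∃ e, IsOmega (MoonPolyomino.transpose (MoonPolyomino.transpose N))
        (MoonPolyomino.transpose K) e := ⟨e₂, he₂⟩
    rwa [transpose_transpose] at h
  obtain ⟨e₂, he₂⟩ := hN'
  obtain ⟨e₃, he₃⟩ := exists_isOmega_translate hK.transpose (-a, -c)
  have hmem : ∀ i j, (i, j) ∈ (MoonPolyomino.transpose K).image (fun p => p + (-a, -c)) ↔
      (j + c, i + a) ∈ K := by
    intro i j
    rw [Finset.mem_image, ← mem_transpose]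
    constructor
    · rintro ⟨⟨i', j'⟩, hp, he⟩
      simp only [Prod.mk_add_mk, Prod.mk.injEq] at he
      obtain ⟨rfl, rfl⟩ := he
      rw [neg_add_cancel_right, neg_add_cancel_right]
      exact hp
    · intro hp
      exact ⟨_, hp, by simp⟩
  -- Sorting the rows only permutes them, so the first column remains the largest.
  have hcK : ∀ i j, (j, i) ∈ K → c ≤ j ∧ (c, i) ∈ K := by
    intro i j hp
    have h1 := (hσ j (σ.symm i)).trans (by rw [Equiv.apply_symm_apply])
    have h2 := hc _ (mem_transpose.1 (h1.2 hp))
    refine ⟨h2.1, ?_⟩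
    have h3 := (hσ c (σ.symm i)).1 (mem_transpose.2 h2.2)
    rwa [Equiv.apply_symm_apply] at h3
  refine ⟨_, ⟨_, (he₁.trans he₂).trans he₃⟩, ⟨?_, ?_⟩, σ.trans (Equiv.addRight (-a)),
    τ.trans (Equiv.addRight (-c)), fun i j => ?_⟩
  · rintro ⟨i, j⟩ hp
    rw [hmem] at hp
    have h1 := hcK _ _ hp
    have h2 := ha _ hp
    simp only at h2 ⊢
    omega
  · intro i j i' j' hp hi hi' hj hj'
    rw [hmem] at *
    have h1 : (j' + c, i + a) ∈ K :=
      (hK.down_convex (i + a)).out (hcK _ _ hp).2 hp ⟨by omega, by omega⟩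
    exact (hK.up_convex (j' + c)).out (ha _ h1).2 h1 ⟨by omega, by omega⟩
  · rw [hmem, hτ, ← mem_transpose, hσ]
    simp

theorem IsYoung.subset {K K' : Finset (ℤ × ℤ)} (hK : IsYoung K) (hK' : IsYoung K')
    {σ τ : Equiv.Perm ℤ} (h : ∀ i j, (i, j) ∈ K ↔ (σ i, τ j) ∈ K') : K ⊆ K' := by
  -- Pigeonhole: `π` cannot inject the `i + 1` integers of `[0, i]` into `[0, i)`.
  have key : ∀ (π : Equiv.Perm ℤ) (i : ℤ), 0 ≤ i → (∀ i₀, 0 ≤ i₀ → i₀ ≤ i → 0 ≤ π i₀) →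
      ∃ i₀, 0 ≤ i₀ ∧ i₀ ≤ i ∧ i ≤ π i₀ := by
    intro π i hi hnonneg
    by_contra! hcon
    obtain ⟨x, -, y, -, hxy, he⟩ := Finset.exists_ne_map_eq_of_card_lt_of_maps_to
      (s := Finset.Icc 0 i) (t := Finset.Ico 0 i) (f := π) (by simpa) (fun x hx => by
        have hx := Finset.mem_Icc.1 hx
        exact Finset.mem_Ico.2 ⟨hnonneg x hx.1 hx.2, hcon x hx.1 hx.2⟩)
    exact hxy (π.injective he)
  rintro ⟨i, j⟩ hp
  obtain ⟨hi, hj⟩ := hK.1 _ hp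
  have hbox : ∀ i₀ j₀, 0 ≤ i₀ → i₀ ≤ i → 0 ≤ j₀ → j₀ ≤ j → (σ i₀, τ j₀) ∈ K' :=
    fun i₀ j₀ h1 h2 h3 h4 => (h i₀ j₀).1 (hK.2 i j i₀ j₀ hp h1 h2 h3 h4)
  obtain ⟨i₀, h1, h2, h3⟩ := key σ i hi fun i₀ h1 h2 => (hK'.1 _ (hbox i₀ 0 h1 h2 le_rfl hj)).1
  obtain ⟨j₀, h4, h5, h6⟩ := key τ j hj fun j₀ h1 h2 => (hK'.1 _ (hbox 0 j₀ le_rfl hi h1 h2)).2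
  -- The box `(i, j)` lies weakly below the image of a box of `K`, hence in the Young diagram `K'`.
  exact hK'.2 _ _ i j (hbox i₀ j₀ h1 h2 h4 h5) hi h3 hj h6

theorem IsYoung.eq {K K' : Finset (ℤ × ℤ)} (hK : IsYoung K) (hK' : IsYoung K')
    {σ τ : Equiv.Perm ℤ} (h : ∀ i j, (i, j) ∈ K ↔ (σ i, τ j) ∈ K') : K = K' :=
  (hK.subset hK' h).antisymm (hK'.subset hK (σ := σ.symm) (τ := τ.symm) fun i j => by
    rw [h, Equiv.apply_symm_apply, Equiv.apply_symm_apply])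

theorem Equivalent.exists_isOmega {M N : Finset (ℤ × ℤ)} (hM : IsMoon M) (hN : IsMoon N)
    (h : Equivalent M N) : ∃ e, IsOmega M N e := by
  obtain ⟨σ, τ, rfl⟩ := h
  rcases M.eq_empty_or_nonempty with rfl | hne
  · exact ⟨_, isOmega_refl hM⟩
  · have hστ : ∀ i j, (i, j) ∈ M ↔ (σ i, τ j) ∈ M.image (fun p => (σ p.1, τ p.2)) := by
      intro i j
      simp
    obtain ⟨K, ⟨e, he⟩, hK, σ₁, τ₁, h₁⟩ := hM.exists_isYoung hne
    obtain ⟨K', ⟨f, hf⟩, hK', σ₂, τ₂, h₂⟩ := hN.exists_isYoung (hne.image _)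
    obtain rfl : K = K' := hK.eq hK' (σ := (σ₁.symm.trans σ).trans σ₂)
      (τ := (τ₁.symm.trans τ).trans τ₂) fun i j => by
        simp only [Equiv.trans_apply]
        rw [← h₂, ← hστ, h₁, Equiv.apply_symm_apply, Equiv.apply_symm_apply]
    exact ⟨_, he.trans hf.symm⟩

end MoonPolyomino

theorem mainTheorem5 (M N : Finset (ℤ × ℤ)) (hM : MoonPolyomino.IsMoon M)
    (hN : MoonPolyomino.IsMoon N) (hMN : MoonPolyomino.Equivalent M N) :
    (∃ Ω : MoonPolyomino.Labeling M ≃ MoonPolyomino.Labeling N, MoonPolyomino.IsOmega M N Ω) ∧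
    ∀ Ω : MoonPolyomino.Labeling M ≃ MoonPolyomino.Labeling N, MoonPolyomino.IsOmega M N Ω →
      ∀ x : MoonPolyomino.Labeling M, (∀ p, 0 ≤ x p) →
        MoonPolyomino.longestSE (Ω x) = MoonPolyomino.longestSE x :=
  ⟨hMN.exists_isOmega hM hN, fun _ hΩ x hx => (hΩ.invariant x).2 hx⟩
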